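/- Let $(\mathcal C,\otimes,1_\otimes)$ be a symmetric monoidal category which has all small limits, with terminal object $\star_{\mathcal C}$. **Notation.** $\Sigma_*$ is the category of finite sets and bijections, $\Sigma_0\subset\Sigma_*$ the full subcategory of empty sets. For $n\ge 1$, $\Sigma_*^{\wr n}$ is the groupoid of level-$n$ trees, i.e. of chains of maps of finite sets $\star\leftarrow S_1\leftarrow\dots\leftarrow S_n$ and their isomorphisms; $\Sigma_*^{\wr (n-1)}\wr\Sigma_0$ is its full subcategory given by $S_n=\emptyset$; and $\gamma^n$ is the functor to $\Sigma_*$ (resp. $\Sigma_0$) sending a tree to its set of leaves $S_n$. A symmetric sequence is a functor $\Sigma_*\to\mathcal C$. For a functor $X$ on level-$m$ trees and a functor $Y$ on level-$n$ trees, $X\circledcirc Y$ is the functor on level-$(m+n)$ trees which sends a level-$m$ tree $F$ with a level-$n$ tree $F_s$ at each leaf $s$ to $X(F)\otimes\bigotimes_s Y(F_s)$; this is associative up to canonical isomorphism. Let $A_1\hat\circ\cdots\hat\circ A_n=\mathrm R_{\gamma^n}(A_1\circledcirc\cdots\circledcirc A_n)$ be the right Kan extension along $\gamma^n$, with universal transformation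 $\iota:(A_1\hat\circ\cdots\hat\circ A_n)\gamma^n\to A_1\circledcirc\cdots\circledcirc A_n$; here $A_1,\dots,A_{n-1}$ are symmetric sequences and $A_n$ is a functor on $\Sigma_*$ or on $\Sigma_0$. (For $n=1$ we take $A_1$ itself.) Let $\mathds 1$ be the symmetric sequence equal to $1_\otimes$ on one-element sets and to $\star_{\mathcal C}$ on all other sets. A *(counital) cooperad* is a symmetric sequence $\mathcal O$ with transformations $\tilde\Delta:\mathcal O\gamma^2\to\mathcal O\circledcirc\mathcal O$ and $\tilde\epsilon:\mathcal O\to\mathds 1$ such that the two transformations $\mathcal O\gamma^3\to\mathcal O\circledcirc\mathcal O\circledcirc\mathcal O$ obtained from $\tilde\Delta$ (applying it a second time to the first or to the second factor) agree, and such that the two composites $\mathcal O\to\mathcal O$ given by $\tilde\Delta$ followed by $\tilde\epsilon$ on the first factor, on the trees $\star\leftarrow\star\leftarrow S$, respectively by $\tilde\epsilon$ on the second factor, on the trees $\star\leftarrow S\xleftarrow{=}S$, are the identity. A *comodule* over $\mathcal O$ is a functor $M:\Sigma_*\to\mathcal C$ with a transformation $\tilde\Delta_M:M\gamma^2\to\mathcal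 O\circledcirc M$ which is coassociative in the same sense (the two transformations $M\gamma^3\to\mathcal O\circledcirc\mathcal O\circledcirc M$ agree) and left counital. A *coalgebra* over $\mathcal O$ is an object $c$ of $\mathcal C$, viewed as a constant functor $\Sigma_0\to\mathcal C$, with such a $\tilde\Delta_c:c\,\gamma^2\to\mathcal O\circledcirc c$ on $\Sigma_*\wr\Sigma_0$. Consider all expressions built from copies of $\mathcal O$ and one $M$ in the last position by iterated (arbitrarily parenthesized) products $(E_1\hat\circ\cdots\hat\circ E_k)$, $k\ge 2$. *Parenthesization maps* are the maps induced on right Kan extensions by applying the universal transformation $\iota$ to a factor which is itself a product; they remove a pair of parentheses, e.g. $(A\hat\circ B)\hat\circ C\to A\hat\circ B\hat\circ C\leftarrow A\hat\circ(B\hat\circ C)$. *Cocomposition maps* are the maps $\Delta:\mathcal O\to\mathcal O\hat\circ\mathcal O$ and $\Delta_M:M\to\mathcal O\hat\circ M$ corresponding to $\tilde\Delta$, $\tilde\Delta_M$, and the maps $\Delta_i:E_1\hat\circ\cdots\hat\circ E_k\to E'_1\hat\circ\cdots\hat\circ E'_{k+1}$ induced on right Kan extensions by applying $\tilde\Delta$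 to a factor $E_i=\mathcal O$ (which becomes $\mathcal O\hat\circ\mathcal O$ without new parentheses) or $\tilde\Delta_M$ to the last factor $E_k=M$. *Combinations* are all transformations obtained from these maps and identities by composition and by functoriality of $\hat\circ$ in the factors. Likewise with $c$ in place of $M$. **Corollary.** Let $\mathcal O$ be a cooperad and $n\ge 1$. 1. For every comodule $M$ over $\mathcal O$ there is exactly one transformation $\Delta^{[n]}_M:M\to\mathcal O^{\hat\circ(n-1)}\hat\circ M=\mathrm R_{\gamma^n}(\mathcal O\circledcirc\cdots\circledcirc\mathcal O\circledcirc M)$ which is a combination of parenthesization maps and cocomposition maps; that is, such combinations exist, and any two of them from $M$ to $\mathcal O^{\hat\circ(n-1)}\hat\circ M$ are equal. 2. For every coalgebra $c$ over $\mathcal O$ there is, in the same sense, exactly one map $\Delta^{[n]}:c\to\mathcal O^{\hat\circ(n-1)}\hat\circ c$ in $\mathcal C$ (the target being evaluated at $\emptyset$) which is a combination of parenthesization maps and cocomposition maps. -/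

import Mathlib

open CategoryTheory MonoidalCategory Limits

universe v u v₁ v₂ v₃ u₁ u₂ u₃

namespace TreeSeq

section Coherence

variable {C : Type u} [Category.{v} C] [MonoidalCategory C] [SymmetricCategory C]

/-- The right-bracketed tensor product of the objects `X v`, for `v` running through a list. -/
def tl {V : Type} (X : V → C) : List V → C
  | [] => 𝟙_ C
  | v :: l => X v ⊗ tl X l

/-- Exchange of the first two factors. -/
def swp (a b z : C) : a ⊗ (b ⊗ z) ⟶ b ⊗ (a ⊗ z) :=
  (α_ a b z).inv ≫ (β_ a b).hom ▷ z ≫ (α_ b a z).hom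

lemma swp_swp (a b z : C) : swp a b z ≫ swp b a z = 𝟙 _ := by
  simp [swp, ← comp_whiskerRight_assoc]

lemma swp_nat {a b z a' b' z' : C} (f : a ⟶ a') (g : b ⟶ b') (h : z ⟶ z') :
    (f ⊗ₘ (g ⊗ₘ h)) ≫ swp a' b' z' = swp a b z ≫ (g ⊗ₘ (f ⊗ₘ h)) := by
  simp only [swp, Category.assoc, ← tensorHom_id]
  rw [associator_inv_naturality_assoc]
  rw [tensorHom_comp_tensorHom_assoc, BraidedCategory.braiding_naturality, ← associator_naturality,
    tensorHom_comp_tensorHom_assoc]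
  simp only [Category.id_comp, Category.comp_id]

lemma swp_nat_left {a b z a' : C} (f : a ⟶ a') :
    f ▷ (b ⊗ z) ≫ swp a' b z = swp a b z ≫ b ◁ (f ▷ z) := by
  simpa using swp_nat f (𝟙 b) (𝟙 z)

lemma swp_nat_right {a b z z' : C} (h : z ⟶ z') :
    a ◁ (b ◁ h) ≫ swp a b z' = swp a b z ≫ b ◁ (a ◁ h) := by
  simpa using swp_nat (𝟙 a) (𝟙 b) h

lemma swp_yb (a b c z : C) :
    a ◁ swp b c z ≫ swp a c (b ⊗ z) ≫ c ◁ swp a b z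
      = swp a b (c ⊗ z) ≫ b ◁ swp a c z ≫ swp b c (a ⊗ z) := by
  calc
    _ = 𝟙 _ ⊗≫ (a ◁ (β_ b c).hom ≫ (α_ a c b).inv ≫ (β_ a c).hom ▷ b ≫
          (α_ c a b).hom ≫ c ◁ (β_ a b).hom) ▷ z ⊗≫ 𝟙 _ := by
      simp only [swp]; monoidal
    _ = _ := by
      rw [← BraidedCategory.yang_baxter]; simp only [swp]; monoidal

/-- `Ins v l l'`: the list `l'` arises from `l` by inserting `v` at one position. -/
inductive Ins {V : Type} (v : V) : List V → List V → Type
  | here (l : List V) : Ins v l (v :: l)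
  | there (a : V) {l l' : List V} (i : Ins v l l') : Ins v (a :: l) (a :: l')

/-- The morphism moving the factor `X v` from the front to the place of insertion. -/
def Ins.interp {V : Type} (X : V → C) {v : V} :
    {l l' : List V} → Ins v l l' → (X v ⊗ tl X l ⟶ tl X l')
  | _, _, .here _ => 𝟙 _
  | _, _, .there a i => swp _ _ _ ≫ X a ◁ i.interp X

/-- `Pm σ l l'`: the list `l'` is a rearrangement of the image of the list `l` under `σ`. -/
inductive Pm {V V' : Type} (σ : V → V') : List V → List V' → Type
  | nil : Pm σ [] []
  | cons (v : V) {l : List V} {l₁ l' : List V'} (p : Pm σ l l₁) (i : Ins (σ v) l₁ l') :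
      Pm σ (v :: l) l'

/-- The morphism that applies `φ v` to each factor and permutes the factors. -/
def Pm.interp {V V' : Type} {X : V → C} {X' : V' → C} {σ : V → V'} (φ : ∀ v, X v ⟶ X' (σ v)) :
    {l : List V} → {l' : List V'} → Pm σ l l' → (tl X l ⟶ tl X' l')
  | _, _, .nil => 𝟙 _
  | _, _, .cons v p i => (φ v ⊗ₘ p.interp φ) ≫ i.interp X'

lemma Ins.swap {V : Type} (X : V → C) {a b : V} {l m n : List V} (i : Ins b l m) (j : Ins a m n) :
    ∃ (m' : List V) (j' : Ins a l m') (i' : Ins b m' n),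
      X a ◁ i.interp X ≫ j.interp X
        = swp (X a) (X b) _ ≫ X b ◁ j'.interp X ≫ i'.interp X := by
  induction j generalizing l with
  | here m =>
    refine ⟨_, .here l, .there a i, ?_⟩
    simp only [Ins.interp, tl, MonoidalCategory.whiskerLeft_id, Category.comp_id, Category.id_comp]
    rw [← Category.assoc, swp_swp, Category.id_comp]
  | there c j ih =>
    cases i with
    | here =>
      refine ⟨_, j, .here _, ?_⟩
      simp [tl, Ins.interp]
    | there _ i =>
      obtain ⟨m', j', i', h⟩ := ih i
      refine ⟨_, .there c j', .there c i', ?_⟩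
      simp only [Ins.interp, tl, MonoidalCategory.whiskerLeft_comp, Category.assoc]
      have e1 := swp_nat_right (a := X a) (b := X c) (i.interp X)
      have e2 := swp_nat_right (a := X b) (b := X c) (j'.interp X)
      rw [reassoc_of% e1, reassoc_of% e2, ← MonoidalCategory.whiskerLeft_comp, h]
      simp only [MonoidalCategory.whiskerLeft_comp]
      have := swp_yb (X a) (X b) (X c)
      rw [reassoc_of% this]

lemma Pm.remove {V V' : Type} {X : V → C} {X' : V' → C} {τ : V → V'} (ψ : ∀ v, X v ⟶ X' (τ v))
    {v : V} {l₁ l' : List V} {l'' : List V'} (i : Ins v l₁ l') (q : Pm τ l' l'') :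
    ∃ (l₂ : List V') (j : Ins (τ v) l₂ l'') (q' : Pm τ l₁ l₂),
      i.interp X ≫ q.interp ψ = (ψ v ⊗ₘ q'.interp ψ) ≫ j.interp X' := by
  induction i generalizing l'' with
  | here l =>
    cases q with
    | cons _ p j => exact ⟨_, j, p, by simp [tl, Ins.interp, Pm.interp]⟩
  | there a i ih =>
    cases q with
    | cons _ p k =>
      obtain ⟨l₂, j, q', h⟩ := ih p
      obtain ⟨m', k', j', h'⟩ := j.swap X' k
      refine ⟨_, j', .cons a q' k', ?_⟩
      simp only [tl, Ins.interp, Pm.interp, Category.assoc]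
      rw [← id_tensorHom, tensorHom_comp_tensorHom_assoc, h, Category.id_comp]
      have e1 : ψ a ⊗ₘ ((ψ v ⊗ₘ q'.interp ψ) ≫ j.interp X')
          = (ψ a ⊗ₘ (ψ v ⊗ₘ q'.interp ψ)) ≫ X' (τ a) ◁ j.interp X' := by
        rw [← id_tensorHom, tensorHom_comp_tensorHom, Category.comp_id]
      rw [e1, Category.assoc, h', ← Category.assoc (ψ a ⊗ₘ _), swp_nat, Category.assoc,
        ← Category.assoc (swp _ _ _), swp_swp, Category.id_comp]
      rw [← id_tensorHom, tensorHom_comp_tensorHom_assoc, Category.comp_id]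

lemma Pm.comp {V V' V'' : Type} {X : V → C} {X' : V' → C} {X'' : V'' → C}
    {σ : V → V'} {τ : V' → V''}
    {φ : ∀ v, X v ⟶ X' (σ v)} {ψ : ∀ v, X' v ⟶ X'' (τ v)}
    {l : List V} {l' : List V'} {l'' : List V''} (p : Pm σ l l') (q : Pm τ l' l'') :
    ∃ r : Pm (fun v => τ (σ v)) l l'',
      p.interp φ ≫ q.interp ψ = r.interp (fun v => φ v ≫ ψ (σ v)) := by
  induction p generalizing l'' with
  | nil => cases q; exact ⟨.nil, by simp [tl, Pm.interp]⟩
  | cons v p i ih =>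
    obtain ⟨l₂, j, q', h⟩ := Pm.remove ψ i q
    obtain ⟨r, hr⟩ := ih q'
    refine ⟨.cons v r j, ?_⟩
    simp only [Pm.interp, tl, Category.assoc, h]
    rw [tensorHom_comp_tensorHom_assoc, hr]

lemma Ins.mem {V : Type} {v : V} {l l' : List V} (i : Ins v l l') : v ∈ l' := by
  induction i <;> simp_all

lemma Ins.perm {V : Type} {v : V} {l l' : List V} (i : Ins v l l') : (v :: l).Perm l' := by
  induction i with
  | here => exact .refl _
  | there a i ih => exact (List.Perm.swap _ _ _).trans (ih.cons a)

lemma Pm.perm {V V' : Type} {σ : V → V'} {l : List V} {l' : List V'} (p : Pm σ l l') :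
    (l.map σ).Perm l' := by
  induction p with
  | nil => exact .refl _
  | cons v p i ih => exact (ih.cons _).trans i.perm

lemma Ins.unique {V : Type} {v : V} {l m l' : List V} (i : Ins v l l') (j : Ins v m l')
    (h : l'.Nodup) : l = m ∧ i ≍ j := by
  induction i generalizing m with
  | here l =>
    cases j with
    | here => exact ⟨rfl, .rfl⟩
    | there _ j => exact absurd j.mem (List.nodup_cons.1 h).1
  | there a i ih =>
    cases j with
    | here => exact absurd i.mem (List.nodup_cons.1 h).1
    | there _ j =>
      obtain ⟨rfl, h'⟩ := ih j (List.nodup_cons.1 h).2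
      cases h'
      exact ⟨rfl, .rfl⟩

lemma Pm.unique {V V' : Type} {σ : V → V'} {l : List V} {l' : List V'} (p q : Pm σ l l')
    (h : l'.Nodup) : p = q := by
  induction p with
  | nil => cases q; rfl
  | cons v p i ih =>
    cases q with
    | cons _ q j =>
      obtain ⟨rfl, h'⟩ := i.unique j h
      cases h'
      rw [ih q (List.nodup_cons.1 (i.perm.nodup_iff.2 h)).2]

lemma Ins.exists {V : Type} (v : V) (s t : List V) : Nonempty (Ins v (s ++ t) (s ++ v :: t)) := by
  induction s with
  | nil => exact ⟨.here _⟩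
  | cons a s ih => exact ih.map (.there a)

lemma Pm.exists {V V' : Type} {σ : V → V'} {l : List V} {l' : List V'}
    (h : (l.map σ).Perm l') : Nonempty (Pm σ l l') := by
  induction l generalizing l' with
  | nil => rw [List.map_nil, List.nil_perm] at h; subst h; exact ⟨.nil⟩
  | cons v l ih =>
    obtain ⟨s, t, rfl⟩ := List.append_of_mem (h.subset List.mem_cons_self)
    obtain ⟨i⟩ := Ins.exists (σ v) s t
    obtain ⟨p⟩ := ih (l' := s ++ t) (List.Perm.cons_inv (h.trans i.perm.symm))
    exact ⟨.cons v p i⟩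

/-- Concatenation of lists corresponds to the tensor product. -/
def app {V : Type} (X : V → C) : (l k : List V) → (tl X l ⊗ tl X k ≅ tl X (l ++ k))
  | [], _ => λ_ _
  | v :: l, k => α_ (X v) (tl X l) (tl X k) ≪≫ whiskerLeftIso (X v) (app X l k)

lemma Ins.append {V : Type} (X : V → C) {v : V} {l l' : List V} (i : Ins v l l') (k : List V) :
    ∃ j : Ins v (l ++ k) (l' ++ k),
      X v ◁ (app X l k).hom ≫ j.interp X = (α_ _ _ _).inv ≫ i.interp X ▷ tl X k ≫ (app X l' k).hom := by
  induction i with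
  | here l => exact ⟨.here _, by simp [tl, Ins.interp, app]⟩
  | @there a l₀ _ i ih =>
    obtain ⟨j, h⟩ := ih
    refine ⟨.there a j, ?_⟩
    simp only [tl, List.cons_append, Ins.interp, app, Iso.trans_hom, whiskerLeftIso_hom]
    rw [MonoidalCategory.whiskerLeft_comp, Category.assoc]
    change _ ≫ X v ◁ X a ◁ (app X l₀ k).hom ≫ swp (X v) (X a) (tl X (l₀ ++ k)) ≫ _ = _
    have e1 := swp_nat_right (a := X v) (b := X a) (app X l₀ k).hom
    rw [reassoc_of% e1, ← MonoidalCategory.whiskerLeft_comp, h]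
    simp only [swp]
    monoidal

lemma Pm.append {V V' : Type} {X : V → C} {X' : V' → C} {σ : V → V'} (φ : ∀ v, X v ⟶ X' (σ v))
    {l k : List V} {l' k' : List V'} (p : Pm σ l l') (q : Pm σ k k') :
    ∃ r : Pm σ (l ++ k) (l' ++ k'),
      (app X l k).hom ≫ r.interp φ = (p.interp φ ⊗ₘ q.interp φ) ≫ (app X' l' k').hom := by
  induction p with
  | nil => exact ⟨q, by simp [tl, Pm.interp, app]⟩
  | @cons v l₀ _ _ p i ih =>
    obtain ⟨r, hr⟩ := ih
    obtain ⟨j, hj⟩ := i.append X' k'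
    refine ⟨.cons v r j, ?_⟩
    simp only [tl, List.cons_append, Pm.interp, app, Iso.trans_hom, whiskerLeftIso_hom,
      Category.assoc]
    rw [← id_tensorHom, tensorHom_comp_tensorHom_assoc, hr, Category.id_comp]
    have e1 {a b c : C} (f : X v ⟶ a) (g : tl X l₀ ⊗ tl X k ⟶ b) (h : b ⟶ c) :
      f ⊗ₘ (g ≫ h) = (f ⊗ₘ g) ≫ a ◁ h := by
      rw [← id_tensorHom, tensorHom_comp_tensorHom, Category.comp_id]
    rw [e1, Category.assoc, hj, associator_inv_naturality_assoc, Iso.hom_inv_id_assoc,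
      ← tensorHom_id, tensorHom_comp_tensorHom_assoc, Category.comp_id]

lemma Pm.refl {V : Type} (X : V → C) (l : List V) :
    ∃ r : Pm (fun v => v) l l, r.interp (X := X) (X' := X) (fun v => 𝟙 (X v)) = 𝟙 _ := by
  induction l with
  | nil => exact ⟨.nil, rfl⟩
  | cons v l ih =>
    obtain ⟨r, hr⟩ := ih
    exact ⟨.cons v r (.here _), by simp [Pm.interp, Ins.interp, tl, hr]⟩

lemma Pm.assoc {V : Type} (X : V → C) (l k m : List V) :
    ∃ r : Pm (fun v => v) ((l ++ k) ++ m) (l ++ (k ++ m)),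
      ((app X l k).hom ▷ _ ≫ (app X (l ++ k) m).hom) ≫
          r.interp (X := X) (X' := X) (fun v => 𝟙 (X v))
        = (α_ _ _ _).hom ≫ _ ◁ (app X k m).hom ≫ (app X l (k ++ m)).hom := by
  induction l with
  | nil =>
    obtain ⟨r, hr⟩ := Pm.refl X (k ++ m)
    exact ⟨r, by simp [tl, hr, app]⟩
  | cons v l ih =>
    obtain ⟨r, hr⟩ := ih
    refine ⟨.cons v r (.here _), ?_⟩
    simp only [tl, List.cons_append, app, Pm.interp, Ins.interp, Iso.trans_hom, whiskerLeftIso_hom,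
      Category.assoc, id_tensorHom, Category.comp_id] at hr ⊢
    calc
      _ = 𝟙 _ ⊗≫ X v ◁ ((app X l k).hom ▷ tl X m ≫ (app X (l ++ k) m).hom ≫
          r.interp (X := X) (X' := X) (fun v => 𝟙 (X v))) := by monoidal
      _ = _ := by rw [hr]; monoidal

lemma Pm.assoc_inv {V : Type} (X : V → C) (l k m : List V) :
    ∃ r : Pm (fun v => v) (l ++ (k ++ m)) ((l ++ k) ++ m),
      (_ ◁ (app X k m).hom ≫ (app X l (k ++ m)).hom) ≫
          r.interp (X := X) (X' := X) (fun v => 𝟙 (X v))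
        = (α_ _ _ _).inv ≫ (app X l k).hom ▷ _ ≫ (app X (l ++ k) m).hom := by
  induction l with
  | nil =>
    obtain ⟨r, hr⟩ := Pm.refl X (k ++ m)
    exact ⟨r, by simp [tl, hr, app]⟩
  | cons v l ih =>
    obtain ⟨r, hr⟩ := ih
    refine ⟨.cons v r (.here _), ?_⟩
    simp only [tl, List.cons_append, app, Pm.interp, Ins.interp, Iso.trans_hom, whiskerLeftIso_hom,
      Category.assoc, id_tensorHom, Category.comp_id] at hr ⊢
    calc
      _ = 𝟙 _ ⊗≫ X v ◁ (tl X l ◁ (app X k m).hom ≫ (app X l (k ++ m)).hom ≫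
          r.interp (X := X) (X' := X) (fun v => 𝟙 (X v))) := by monoidal
      _ = _ := by rw [hr]; monoidal

lemma Ins.block {V : Type} (X : V → C) (a : V) (m l : List V) :
    ∃ i : Ins a (m ++ l) (m ++ a :: l),
      X a ◁ (app X m l).hom ≫ i.interp X = swp _ _ _ ≫ (app X m (a :: l)).hom := by
  induction m with
  | nil =>
    refine ⟨.here _, ?_⟩
    simp [tl, Ins.interp, app, swp]
  | cons b m ih =>
    obtain ⟨i, hi⟩ := ih
    refine ⟨.there b i, ?_⟩
    dsimp only [List.cons_append, tl, Ins.interp, app, Iso.trans_hom, whiskerLeftIso_hom] at hi ⊢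
    rw [MonoidalCategory.whiskerLeft_comp, Category.assoc]
    change _ ≫ X a ◁ X b ◁ (app X m l).hom ≫ swp (X a) (X b) (tl X (m ++ l)) ≫ _
      = _ ≫ _ ≫ X b ◁ (app X m (a :: l)).hom
    have e1 := swp_nat_right (a := X a) (b := X b) (app X m l).hom
    rw [reassoc_of% e1, ← MonoidalCategory.whiskerLeft_comp, hi]
    simp only [swp, BraidedCategory.braiding_tensor_right_hom]
    monoidal

lemma Pm.unit {V : Type} (X : V → C) (l : List V) :
    ∃ r : Pm (fun v => v) l (l ++ []),
      r.interp (X := X) (X' := X) (fun v => 𝟙 (X v)) = (ρ_ _).inv ≫ (app X l []).hom := by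
  induction l with
  | nil => exact ⟨.nil, by simp [tl, Pm.interp, app, unitors_equal]⟩
  | cons v l ih =>
    obtain ⟨r, hr⟩ := ih
    refine ⟨.cons v r (.here _), ?_⟩
    simp only [tl, List.cons_append, app, Pm.interp, Ins.interp, Iso.trans_hom, whiskerLeftIso_hom,
      id_tensorHom, Category.comp_id, hr]
    simp
    rfl

lemma Pm.braid {V : Type} (X : V → C) (l m : List V) :
    ∃ r : Pm (fun v => v) (l ++ m) (m ++ l),
      (app X l m).hom ≫ r.interp (X := X) (X' := X) (fun v => 𝟙 (X v))
        = (β_ _ _).hom ≫ (app X m l).hom := by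
  induction l with
  | nil =>
    obtain ⟨r, hr⟩ := Pm.unit X m
    exact ⟨r, by simp [tl, hr, app]⟩
  | cons a l ih =>
    obtain ⟨r, hr⟩ := ih
    obtain ⟨i, hi⟩ := Ins.block X a m l
    refine ⟨.cons a r i, ?_⟩
    simp only [tl, List.cons_append, Pm.interp, app, Iso.trans_hom, whiskerLeftIso_hom,
      Category.assoc, id_tensorHom] at hi ⊢
    rw [← MonoidalCategory.whiskerLeft_comp_assoc, hr, MonoidalCategory.whiskerLeft_comp_assoc, hi]
    simp [swp, BraidedCategory.braiding_tensor_left_hom]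

/-- A way of writing an object of `C` as a bracketed tensor product of the unit and objects `X v`. -/
inductive Wd {V : Type} (X : V → C) : C → Type u
  | one : Wd X (𝟙_ C)
  | of (v : V) : Wd X (X v)
  | mul {a b : C} (w : Wd X a) (w' : Wd X b) : Wd X (a ⊗ b)

/-- The list of indices occurring in a bracketed tensor product. -/
def Wd.leaves {V : Type} {X : V → C} : {a : C} → Wd X a → List V
  | _, .one => []
  | _, .of v => [v]
  | _, .mul w w' => w.leaves ++ w'.leaves

/-- Rebracketing to the right and removing units. -/
def Wd.nf {V : Type} {X : V → C} : {a : C} → (w : Wd X a) → (a ≅ tl X w.leaves)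
  | _, .one => Iso.refl _
  | _, .of v => (ρ_ (X v)).symm
  | _, .mul w w' => (w.nf ⊗ᵢ w'.nf) ≪≫ app X w.leaves w'.leaves

/-- `f` applies `φ v` to each factor `X v` and then rearranges factors by a composite of
associativity, unit and symmetry isomorphisms. -/
def Fm {V V' : Type} {X : V → C} {X' : V' → C} (σ : V → V') (φ : ∀ v, X v ⟶ X' (σ v))
    {a a' : C} (w : Wd X a) (w' : Wd X' a') (f : a ⟶ a') : Prop :=
  ∃ p : Pm σ w.leaves w'.leaves, f ≫ w'.nf.hom = w.nf.hom ≫ p.interp φ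

section

variable {V V' V'' : Type} {X : V → C} {X' : V' → C} {X'' : V'' → C}
  {σ : V → V'} {φ : ∀ v, X v ⟶ X' (σ v)}

/-- Coherence: such a morphism is unique as soon as no index is repeated. -/
lemma Fm.unique {a a' : C} {w : Wd X a} {w' : Wd X' a'} {f g : a ⟶ a'}
    (hf : Fm σ φ w w' f) (hg : Fm σ φ w w' g) (h : w'.leaves.Nodup) : f = g := by
  obtain ⟨p, hp⟩ := hf
  obtain ⟨q, hq⟩ := hg
  rw [← cancel_mono w'.nf.hom, hp, hq, p.unique q h]

lemma Fm.exists {a a' : C} (w : Wd X a) (w' : Wd X' a')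
    (h : (w.leaves.map σ).Perm w'.leaves) : ∃ f, Fm σ φ w w' f := by
  obtain ⟨p⟩ := Pm.exists h
  exact ⟨w.nf.hom ≫ p.interp φ ≫ w'.nf.inv, p, by simp⟩

lemma Fm.comp {τ : V' → V''} {ψ : ∀ v, X' v ⟶ X'' (τ v)} {χ : ∀ v, X v ⟶ X'' (τ (σ v))}
    {a a' a'' : C} {w : Wd X a} {w' : Wd X' a'} {w'' : Wd X'' a''} {f : a ⟶ a'} {g : a' ⟶ a''}
    (hf : Fm σ φ w w' f) (hg : Fm τ ψ w' w'' g) (hχ : ∀ v, φ v ≫ ψ (σ v) = χ v) :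
    Fm (fun v => τ (σ v)) χ w w'' (f ≫ g) := by
  obtain rfl : (fun v => φ v ≫ ψ (σ v)) = χ := funext hχ
  obtain ⟨p, hp⟩ := hf
  obtain ⟨q, hq⟩ := hg
  obtain ⟨r, hr⟩ := p.comp q (φ := φ) (ψ := ψ)
  exact ⟨r, by rw [Category.assoc, hq, reassoc_of% hp, hr]⟩

lemma Fm.of (v : V) : Fm σ φ (.of v) (.of (σ v)) (φ v) :=
  ⟨.cons v .nil (.here _), by simp [Wd.nf, Pm.interp, Ins.interp, Wd.leaves, tl]⟩

lemma Fm.one : Fm σ φ .one .one (𝟙 _) :=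
  ⟨.nil, by simp [Wd.nf, Pm.interp, Wd.leaves, tl]⟩

lemma Fm.mul {a a' b b' : C} {w : Wd X a} {w' : Wd X' a'} {f : a ⟶ a'} {u : Wd X b}
    {u' : Wd X' b'} {g : b ⟶ b'} (hf : Fm σ φ w w' f) (hg : Fm σ φ u u' g) :
    Fm σ φ (.mul w u) (.mul w' u') (f ⊗ₘ g) := by
  obtain ⟨p, hp⟩ := hf
  obtain ⟨q, hq⟩ := hg
  obtain ⟨r, hr⟩ := p.append φ q
  refine ⟨r, ?_⟩
  simp only [Wd.nf, Wd.leaves, Iso.trans_hom, tensorIso_hom, Category.assoc]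
  rw [hr, tensorHom_comp_tensorHom_assoc, hp, hq, tensorHom_comp_tensorHom_assoc]

lemma Fm.id {a : C} (w : Wd X a) : Fm (fun v => v) (fun v => 𝟙 (X v)) w w (𝟙 a) := by
  obtain ⟨r, hr⟩ := Pm.refl X w.leaves
  exact ⟨r, by rw [hr]; simp⟩

lemma Wd.nf_left {a b c : C} (w : Wd X a) (w' : Wd X b) (w'' : Wd X c) :
    (Wd.mul (.mul w w') w'').nf.hom = ((w.nf.hom ⊗ₘ w'.nf.hom) ⊗ₘ w''.nf.hom) ≫
      (app X w.leaves w'.leaves).hom ▷ _ ≫ (app X (w.leaves ++ w'.leaves) w''.leaves).hom := by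
  simp only [Wd.nf, Wd.leaves, Iso.trans_hom, tensorIso_hom]
  rw [← tensorHom_id, tensorHom_comp_tensorHom_assoc, Category.comp_id]

lemma Wd.nf_right {a b c : C} (w : Wd X a) (w' : Wd X b) (w'' : Wd X c) :
    (Wd.mul w (.mul w' w'')).nf.hom = (w.nf.hom ⊗ₘ (w'.nf.hom ⊗ₘ w''.nf.hom)) ≫
      _ ◁ (app X w'.leaves w''.leaves).hom ≫ (app X w.leaves (w'.leaves ++ w''.leaves)).hom := by
  simp only [Wd.nf, Wd.leaves, Iso.trans_hom, tensorIso_hom]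
  rw [← id_tensorHom, tensorHom_comp_tensorHom_assoc, Category.comp_id]

lemma Fm.assoc {a b c : C} (w : Wd X a) (w' : Wd X b) (w'' : Wd X c) :
    Fm (fun v => v) (fun v => 𝟙 (X v)) (.mul (.mul w w') w'') (.mul w (.mul w' w''))
      (α_ a b c).hom := by
  obtain ⟨r, hr⟩ := Pm.assoc X w.leaves w'.leaves w''.leaves
  refine ⟨r, ?_⟩
  refine Eq.trans ((congrArg ((α_ a b c).hom ≫ ·) (Wd.nf_right w w' w'')).trans
    (associator_naturality_assoc _ _ _ _).symm) ?_
  refine Eq.trans (congrArg (((w.nf.hom ⊗ₘ w'.nf.hom) ⊗ₘ w''.nf.hom) ≫ ·) hr.symm) ?_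
  exact (Category.assoc _ _ _).symm.trans (congrArg (· ≫ _) (Wd.nf_left w w' w'').symm)

lemma Fm.assoc_inv {a b c : C} (w : Wd X a) (w' : Wd X b) (w'' : Wd X c) :
    Fm (fun v => v) (fun v => 𝟙 (X v)) (.mul w (.mul w' w'')) (.mul (.mul w w') w'')
      (α_ a b c).inv := by
  obtain ⟨r, hr⟩ := Pm.assoc_inv X w.leaves w'.leaves w''.leaves
  refine ⟨r, ?_⟩
  refine Eq.trans ((congrArg ((α_ a b c).inv ≫ ·) (Wd.nf_left w w' w'')).trans
    (associator_inv_naturality_assoc _ _ _ _).symm) ?_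
  refine Eq.trans (congrArg ((w.nf.hom ⊗ₘ (w'.nf.hom ⊗ₘ w''.nf.hom)) ≫ ·) hr.symm) ?_
  exact (Category.assoc _ _ _).symm.trans (congrArg (· ≫ _) (Wd.nf_right w w' w'').symm)

lemma Fm.braid {a b : C} (w : Wd X a) (w' : Wd X b) :
    Fm (fun v => v) (fun v => 𝟙 (X v)) (.mul w w') (.mul w' w) (β_ a b).hom := by
  obtain ⟨r, hr⟩ := Pm.braid X w.leaves w'.leaves
  refine ⟨r, ?_⟩
  simp only [Wd.nf, Wd.leaves, Iso.trans_hom, tensorIso_hom, Category.assoc]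
  rw [hr, BraidedCategory.braiding_naturality_assoc]

lemma Fm.swp {a b z : C} (w : Wd X a) (w' : Wd X b) (w'' : Wd X z) :
    Fm (fun v => v) (fun v => 𝟙 (X v)) (.mul w (.mul w' w'')) (.mul w' (.mul w w''))
      (swp a b z) := by
  refine (Fm.assoc_inv w w' w'').comp (((Fm.braid w w').mul (Fm.id w'')).comp
    (Fm.assoc w' w w'') (χ := fun v => 𝟙 (X v)) fun _ => Category.comp_id _)
      (fun _ => Category.comp_id _) |> cast ?_
  simp [TreeSeq.swp]

end

/-- The bracketing of `tl Z l` obtained from bracketings of all the objects `Z t`. -/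
def Wd.tl {V T : Type} {X : V → C} {Z : T → C} (w : ∀ t, Wd X (Z t)) :
    (l : List T) → Wd X (tl Z l)
  | [] => .one
  | t :: l => .mul (w t) (Wd.tl w l)

lemma Wd.leaves_tl {V T : Type} {X : V → C} {Z : T → C} (w : ∀ t, Wd X (Z t)) (l : List T) :
    (Wd.tl w l).leaves = l.flatMap fun t => (w t).leaves := by
  induction l with
  | nil => rfl
  | cons t l ih => simp [Wd.tl, Wd.leaves, ih]

lemma Fm.ins {V T : Type} {X : V → C} {Z : T → C} (w : ∀ t, Wd X (Z t)) {t : T} {l l' : List T}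
    (i : Ins t l l') :
    Fm (fun v => v) (fun v => 𝟙 (X v)) (.mul (w t) (Wd.tl w l)) (Wd.tl w l') (i.interp Z) := by
  induction i with
  | here l => exact Fm.id _
  | there a i ih =>
    exact (Fm.swp (w t) (w a) _).comp (id_tensorHom (Z a) (i.interp Z) ▸ (Fm.id (w a)).mul ih)
      fun _ => Category.comp_id _

lemma Fm.tl {V V' T T' : Type} {X : V → C} {X' : V' → C} {Z : T → C} {Z' : T' → C}
    {σ : V → V'} {φ : ∀ v, X v ⟶ X' (σ v)} {τ : T → T'} {ψ : ∀ t, Z t ⟶ Z' (τ t)}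
    {w : ∀ t, Wd X (Z t)} {w' : ∀ t, Wd X' (Z' t)} (h : ∀ t, Fm σ φ (w t) (w' (τ t)) (ψ t))
    {l : List T} {l' : List T'} (p : Pm τ l l') :
    Fm σ φ (Wd.tl w l) (Wd.tl w' l') (p.interp ψ) := by
  induction p with
  | nil => exact Fm.one
  | cons t p i ih => exact ((h t).mul ih).comp (Fm.ins w' i) fun _ => Category.comp_id _

end Coherence

/-- A finite set, as an object of the category `Σ_*`. -/
structure FinBij : Type 1 where
  /-- the underlying set -/
  carrier : Type
  [fin : Finite carrier]

attribute [instance] FinBij.fin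

/-- `Σ_*`: the category of finite sets and bijections. -/
instance : Category.{0} FinBij where
  Hom S T := S.carrier ≃ T.carrier
  id S := Equiv.refl S.carrier
  comp f g := f.trans g

/-- An object of `Σ_* ≀ A`: a finite set with an object of `A` for each of its elements. -/
structure Wreath (A : Type u₁) : Type (max 1 u₁) where
  /-- the finite set -/
  idx : FinBij
  /-- the decorations -/
  lbl : idx.carrier → A

namespace Wreath

variable {A : Type u₁} [Category.{v₁} A] {B : Type u₂} [Category.{v₂} B]
  {D : Type u₃} [Category.{v₃} D]

/-- A morphism of `Σ_* ≀ A`: a bijection of the finite sets together with a morphism of `A`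
for each element. -/
structure Hom (x y : Wreath A) : Type v₁ where
  /-- the bijection -/
  σ : x.idx.carrier ≃ y.idx.carrier
  /-- the morphisms of decorations -/
  φ : ∀ s, x.lbl s ⟶ y.lbl (σ s)

lemma Hom.ext' {x y : Wreath A} {f g : Hom x y} (h : ∀ s, f.σ s = g.σ s)
    (h' : ∀ s, f.φ s ≫ eqToHom (congrArg y.lbl (h s)) = g.φ s) : f = g := by
  obtain ⟨σ, φ⟩ := f
  obtain ⟨τ, ψ⟩ := g
  obtain rfl : σ = τ := Equiv.ext h
  obtain rfl : φ = ψ := funext fun s => by simpa using h' s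
  rfl

lemma Hom.congr {x y : Wreath A} (σ : x.idx.carrier ≃ y.idx.carrier)
    {φ ψ : ∀ s, x.lbl s ⟶ y.lbl (σ s)} (h : ∀ s, φ s = ψ s) : Hom.mk σ φ = Hom.mk σ ψ :=
  congrArg _ (funext h)

instance : Category.{v₁} (Wreath A) where
  Hom := Hom
  id x := ⟨Equiv.refl _, fun s => 𝟙 (x.lbl s)⟩
  comp f g := ⟨f.σ.trans g.σ, fun s => f.φ s ≫ g.φ (f.σ s)⟩
  id_comp _ := Hom.congr _ fun _ => Category.id_comp _
  comp_id _ := Hom.congr _ fun _ => Category.comp_id _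
  assoc _ _ _ := Hom.congr _ fun _ => Category.assoc _ _ _

variable (A) in
/-- The functor forgetting the decorations. -/
def forget : Wreath A ⥤ FinBij where
  obj x := x.idx
  map f := f.σ

/-- The functor `Σ_* ≀ F`. -/
def map (F : A ⥤ B) : Wreath A ⥤ Wreath B where
  obj x := ⟨x.idx, fun s => F.obj (x.lbl s)⟩
  map f := ⟨f.σ, fun s => F.map (f.φ s)⟩
  map_id _ := Hom.congr _ fun _ => F.map_id _
  map_comp _ _ := Hom.congr _ fun _ => F.map_comp _ _

/-- `Σ_* ≀ α` for a natural transformation `α`. -/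
def mapNat {F G : A ⥤ B} (α : F ⟶ G) : map F ⟶ map G where
  app x := ⟨Equiv.refl _, fun s => α.app (x.lbl s)⟩
  naturality _ _ f := Hom.ext' (fun _ => rfl) fun s =>
    (Category.comp_id _).trans (α.naturality (f.φ s))

/-- `Σ_* ≀ α` for a natural isomorphism `α`. -/
def mapNatIso {F G : A ⥤ B} (α : F ≅ G) : map F ≅ map G where
  hom := mapNat α.hom
  inv := mapNat α.inv
  hom_inv_id := NatTrans.ext (funext fun _ => Hom.ext' (fun _ => rfl) fun _ =>
    (Category.comp_id _).trans (α.hom_inv_id_app _))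
  inv_hom_id := NatTrans.ext (funext fun _ => Hom.ext' (fun _ => rfl) fun _ =>
    (Category.comp_id _).trans (α.inv_hom_id_app _))

variable (A) in
/-- The functor `γ² ≀ A : Σ_* ≀ (Σ_* ≀ A) ⥤ Σ_* ≀ A` taking a family of decorated sets to its
disjoint union. -/
def mu : Wreath (Wreath A) ⥤ Wreath A where
  obj x := ⟨⟨Σ t, (x.lbl t).idx.carrier⟩, fun s => (x.lbl s.1).lbl s.2⟩
  map f := ⟨Equiv.sigmaCongr f.σ fun t => (f.φ t).σ, fun s => (f.φ s.1).φ s.2⟩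
  map_id _ := Hom.ext' (fun _ => rfl) fun _ => Category.comp_id _
  map_comp _ _ := Hom.ext' (fun _ => rfl) fun _ => Category.comp_id _

/-- The one-element set decorated by `a`. -/
def unit (a : A) : Wreath A := ⟨⟨PUnit⟩, fun _ => a⟩

end Wreath

section Tensor

variable {C : Type u} [Category.{v} C] [MonoidalCategory C] [SymmetricCategory C]

/-- A chosen enumeration of a finite set. -/
noncomputable def enum (S : Type) [Finite S] : List S :=
  (@Finset.univ S (Fintype.ofFinite S)).toList

lemma enum_nodup (S : Type) [Finite S] : (enum S).Nodup := Finset.nodup_toList _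

lemma mem_enum {S : Type} [Finite S] (s : S) : s ∈ enum S := by simp [enum]

lemma enum_perm {S T : Type} [Finite S] [Finite T] (e : S ≃ T) :
    ((enum S).map e).Perm (enum T) :=
  (List.perm_ext_iff_of_nodup ((enum_nodup S).map e.injective) (enum_nodup T)).2 fun t =>
    ⟨fun _ => mem_enum t, fun _ => List.mem_map.2 ⟨e.symm t, mem_enum _, by simp⟩⟩

lemma Pm.interp_unique {V V' : Type} {X : V → C} {X' : V' → C} {σ : V → V'}
    {φ : ∀ v, X v ⟶ X' (σ v)} {l : List V} {l' : List V'} (p q : Pm σ l l') (h : l'.Nodup) :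
    p.interp φ = q.interp φ := by
  rw [p.unique q h]

variable (C) in
/-- The tensor product `⨂_{s ∈ S} X s` over a finite set, as a functor of the family. A bijection
of index sets acts by permuting the factors. -/
noncomputable def bigTensor : Wreath C ⥤ C where
  obj x := tl x.lbl (enum x.idx.carrier)
  map f := (Pm.exists (enum_perm f.σ)).some.interp f.φ
  map_id x := by
    obtain ⟨r, hr⟩ := Pm.refl x.lbl (enum x.idx.carrier)
    exact (Pm.interp_unique (φ := fun v => 𝟙 (x.lbl v)) _ r (enum_nodup _)).trans hr
  map_comp f g := by
    obtain ⟨r, hr⟩ := Pm.comp (φ := f.φ) (ψ := g.φ) (Pm.exists (enum_perm f.σ)).some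
      (Pm.exists (enum_perm g.σ)).some
    exact (Pm.interp_unique (φ := fun v => f.φ v ≫ g.φ (f.σ v)) _ r (enum_nodup _)).trans hr.symm

lemma Fm.bigTensor {V V' : Type} {X : V → C} {X' : V' → C} {σ : V → V'} {φ : ∀ v, X v ⟶ X' (σ v)}
    {x y : Wreath C} {w : ∀ s, Wd X (x.lbl s)} {w' : ∀ s, Wd X' (y.lbl s)} (f : x ⟶ y)
    (h : ∀ s, Fm σ φ (w s) (w' (f.σ s)) (f.φ s)) :
    Fm σ φ (Wd.tl w (enum x.idx.carrier)) (Wd.tl w' (enum y.idx.carrier))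
      ((bigTensor C).map f) :=
  Fm.tl h _

section Distr

variable {T : Type} [Finite T] (g : T → C) (L : T → Wreath C)

/-- The factors occurring in `⨂ t, (g t ⊗ ⨂ s, (L t) s)`. -/
def distrLbl : T ⊕ (Σ t, (L t).idx.carrier) → C
  | .inl t => g t
  | .inr s => (L s.1).lbl s.2

/-- The bracketing `(⨂ t, g t) ⊗ ⨂ (t, s), (L t) s`. -/
noncomputable def distrSrc :
    Wd (distrLbl g L) (tl g (enum T) ⊗
      tl (fun s : Σ t, (L t).idx.carrier => (L s.1).lbl s.2) (enum _)) :=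
  .mul (Wd.tl (X := distrLbl g L) (fun t => .of (.inl t)) _)
    (Wd.tl (X := distrLbl g L) (fun s => .of (.inr s)) _)

/-- The bracketing `⨂ t, (g t ⊗ ⨂ s, (L t) s)`. -/
noncomputable def distrTgt :
    Wd (distrLbl g L) (tl (fun t => g t ⊗ (bigTensor C).obj (L t)) (enum T)) :=
  Wd.tl (X := distrLbl g L) (fun t => .mul (.of (.inl t))
    (Wd.tl (X := distrLbl g L) (fun s => .of (.inr ⟨t, s⟩)) _)) _

lemma distrSrc_leaves :
    (distrSrc g L).leaves = (enum T).map .inl ++ (enum (Σ t, (L t).idx.carrier)).map .inr :=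
  congrArg₂ (· ++ ·) ((Wd.leaves_tl _ _).trans (List.flatMap_pure_eq_map _ _))
    ((Wd.leaves_tl _ _).trans (List.flatMap_pure_eq_map _ _))

lemma distrTgt_leaves :
    (distrTgt g L).leaves = (enum T).flatMap fun t =>
      .inl t :: (enum (L t).idx.carrier).map fun s => .inr ⟨t, s⟩ :=
  (Wd.leaves_tl _ _).trans (congrArg (fun h => (enum T).flatMap h) (funext fun _ =>
    congrArg (List.cons _) ((Wd.leaves_tl _ _).trans (List.flatMap_pure_eq_map _ _))))

lemma distrSrc_nodup : (distrSrc g L).leaves.Nodup := by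
  rw [distrSrc_leaves]
  refine List.Nodup.append ((enum_nodup _).map Sum.inl_injective)
    ((enum_nodup _).map Sum.inr_injective) ?_
  simp [List.Disjoint]

lemma distrTgt_nodup : (distrTgt g L).leaves.Nodup := by
  rw [distrTgt_leaves, List.nodup_flatMap]
  refine ⟨fun t _ => List.nodup_cons.2 ⟨by simp, (enum_nodup _).map ?_⟩, ?_⟩
  · intro s s' h
    simpa using h
  · refine (enum_nodup T).imp fun {t t'} h => ?_
    simp only [Function.onFun, List.Disjoint]
    intro v hv hv'
    cases v <;> simp_all
    grind

lemma distr_perm : ((distrSrc g L).leaves.map fun v => v).Perm (distrTgt g L).leaves := by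
  rw [List.map_id']
  refine (List.perm_ext_iff_of_nodup (distrSrc_nodup g L) (distrTgt_nodup g L)).2 fun v => ?_
  rw [distrSrc_leaves, distrTgt_leaves]
  rcases v with t | ⟨t, s⟩ <;> simp [mem_enum]

/-- The canonical rearrangement
`(⨂ t, g t) ⊗ ⨂ (t, s), (L t) s ⟶ ⨂ t, (g t ⊗ ⨂ s, (L t) s)`. -/
noncomputable def distrApp :
    tl g (enum T) ⊗ tl (fun s : Σ t, (L t).idx.carrier => (L s.1).lbl s.2) (enum _) ⟶
      tl (fun t => g t ⊗ (bigTensor C).obj (L t)) (enum T) :=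
  (Fm.exists (σ := fun v => v) (φ := fun v => 𝟙 (distrLbl g L v)) (distrSrc g L) (distrTgt g L)
    (distr_perm g L)).choose

lemma distrApp_fm :
    Fm (fun v => v) (fun v => 𝟙 (distrLbl g L v)) (distrSrc g L) (distrTgt g L) (distrApp g L) :=
  (Fm.exists (σ := fun v => v) (φ := fun v => 𝟙 (distrLbl g L v)) (distrSrc g L) (distrTgt g L)
    (distr_perm g L)).choose_spec

end Distr

/-- The rearrangement `(⨂ t, G e_t) ⊗ ⨂ (t, s), (L e_t) s ⟶ ⨂ t, (G e_t ⊗ ⨂ s, (L e_t) s)`,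
natural in the family `e`. -/
noncomputable def distr {A : Type u₁} [Category.{v₁} A] (G : A ⥤ C) (L : A ⥤ Wreath C) :
    (Wreath.map G ⋙ bigTensor C) ⊗ (Wreath.map L ⋙ Wreath.mu C ⋙ bigTensor C) ⟶
      Wreath.map (G ⊗ (L ⋙ bigTensor C)) ⋙ bigTensor C where
  app x := distrApp (fun t => G.obj (x.lbl t)) (fun t => L.obj (x.lbl t))
  naturality x y f := by
    let X := distrLbl (fun t => G.obj (x.lbl t)) (fun t => L.obj (x.lbl t))
    let Y := distrLbl (fun t => G.obj (y.lbl t)) (fun t => L.obj (y.lbl t))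
    let σ : x.idx.carrier ⊕ (Σ t, (L.obj (x.lbl t)).idx.carrier) →
        y.idx.carrier ⊕ (Σ t, (L.obj (y.lbl t)).idx.carrier) :=
      Sum.map f.σ (fun s => ⟨f.σ s.1, (L.map (f.φ s.1)).σ s.2⟩)
    let φ : ∀ v, X v ⟶ Y (σ v) := fun v => match v with
      | .inl t => G.map (f.φ t)
      | .inr s => (L.map (f.φ s.1)).φ s.2
    refine Fm.unique (σ := σ) (φ := φ) (w := distrSrc _ _) (w' := distrTgt _ _) ?_ ?_
      (distrTgt_nodup _ _)
    · refine Fm.comp (σ := σ) (φ := φ) (w' := distrSrc _ _) ?_ (distrApp_fm _ _)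
        fun _ => Category.comp_id _
      exact Fm.mul (Fm.bigTensor ((Wreath.map G).map f) fun t => Fm.of (σ := σ) (φ := φ) (.inl t))
        (Fm.bigTensor ((Wreath.map L ⋙ Wreath.mu C).map f)
          fun s => Fm.of (σ := σ) (φ := φ) (.inr s))
    · refine Fm.comp (τ := σ) (ψ := φ) (w' := distrTgt _ _) (distrApp_fm _ _) ?_
        fun _ => Category.id_comp _
      exact Fm.bigTensor ((Wreath.map (G ⊗ (L ⋙ bigTensor C))).map f) fun t =>
        Fm.mul (Fm.of (σ := σ) (φ := φ) (.inl t))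
          (Fm.bigTensor (L.map (f.φ t)) fun s => Fm.of (σ := σ) (φ := φ) (.inr ⟨t, s⟩))

end Tensor

/-- The functor `γ² : Σ_* ≀ Σ_* ⥤ Σ_*` taking a family of finite sets to its disjoint union. -/
def gammaTwo : Wreath FinBij ⥤ FinBij where
  obj x := ⟨Σ t, (x.lbl t).carrier⟩
  map f := Equiv.sigmaCongr f.σ f.φ
  map_id _ := Equiv.ext fun _ => rfl
  map_comp _ _ := Equiv.ext fun _ => rfl

/-- `Σ_0`: the category of empty sets and bijections. -/
structure EmptyBij : Type 1 where
  /-- the underlying finite set -/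
  set : FinBij
  [isEmpty : IsEmpty set.carrier]

attribute [instance] EmptyBij.isEmpty

instance : Category.{0} EmptyBij where
  Hom S T := S.set ⟶ T.set
  id S := 𝟙 S.set
  comp f g := f ≫ g

/-- The functor `Σ_* ≀ Σ_0 ⥤ Σ_0` taking a family of empty sets to its disjoint union. -/
def gammaTwoZero : Wreath EmptyBij ⥤ EmptyBij where
  obj x :=
    have : IsEmpty (Σ t, (x.lbl t).set.carrier) := ⟨fun s => isEmptyElim s.2⟩
    { set := ⟨Σ t, (x.lbl t).set.carrier⟩ }
  map f := Equiv.sigmaCongr f.σ f.φ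
  map_id _ := Equiv.ext fun _ => rfl
  map_comp _ _ := Equiv.ext fun _ => rfl

/-- An isomorphism of `Σ_*` from a bijection. -/
def isoOfEquiv {S T : FinBij} (e : S.carrier ≃ T.carrier) : S ≅ T where
  hom := e
  inv := e.symm
  hom_inv_id := Equiv.self_trans_symm e
  inv_hom_id := Equiv.symm_trans_self e

/-- An isomorphism of `Σ_0` from a bijection. -/
def isoOfEquivZero {S T : EmptyBij} (e : S.set.carrier ≃ T.set.carrier) : S ≅ T where
  hom := e
  inv := e.symm
  hom_inv_id := Equiv.self_trans_symm e
  inv_hom_id := Equiv.symm_trans_self e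

instance : EssentiallySmall.{0} FinBij := by
  refine (essentiallySmall_iff _).2 ⟨small_of_surjective (α := ℕ)
    (f := fun n => toSkeleton (⟨Fin n⟩ : FinBij)) fun X => ?_, inferInstance⟩
  obtain ⟨S, rfl⟩ := Quotient.exists_rep X
  obtain ⟨n, ⟨e⟩⟩ := Finite.exists_equiv_fin S.carrier
  exact ⟨n, Quotient.sound ⟨isoOfEquiv e.symm⟩⟩

instance : EssentiallySmall.{0} EmptyBij := by
  refine (essentiallySmall_iff _).2 ⟨small_of_surjective (α := PUnit.{1})
    (f := fun _ => toSkeleton ({ set := ⟨PEmpty⟩ } : EmptyBij)) fun X => ?_, inferInstance⟩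
  obtain ⟨S, rfl⟩ := Quotient.exists_rep X
  exact ⟨⟨⟩, Quotient.sound ⟨isoOfEquivZero (Equiv.equivOfIsEmpty _ _)⟩⟩

/-- The categories over which Kan extensions are formed. There are two of them, `Base.sigma`
(for comodules) and `Base.zero` (for coalgebras); the structure only serves to treat both at once. -/
structure Base where
  /-- the category `Σ_*` or `Σ_0` -/
  B : Type 1
  [cat : Category.{0} B]
  [small : EssentiallySmall.{0} B]
  /-- disjoint unions of families -/
  act : Wreath B ⥤ B
  /-- `γ² s₀ ≅ id` -/
  unitIso (b : B) : act.obj (Wreath.unit b) ≅ b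
  /-- associativity of disjoint unions, `γ² (γ² ≀ id) ≅ γ² (id ≀ γ²)` -/
  assocIso : Wreath.mu B ⋙ act ≅ Wreath.map act ⋙ act

attribute [instance] Base.cat Base.small

/-- The base `Σ_*`. -/
abbrev Base.sigma : Base where
  B := FinBij
  act := gammaTwo
  unitIso b := isoOfEquiv (Equiv.uniqueSigma fun _ : PUnit => b.carrier)
  assocIso := NatIso.ofComponents
    (fun x => isoOfEquiv (Equiv.sigmaAssoc fun t s => ((x.lbl t).lbl s).carrier))
    fun _ => Equiv.ext fun _ => rfl

/-- The base `Σ_0`. -/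
abbrev Base.zero : Base where
  B := EmptyBij
  act := gammaTwoZero
  unitIso b := isoOfEquivZero (Equiv.uniqueSigma fun _ : PUnit => b.set.carrier)
  assocIso := NatIso.ofComponents
    (fun x => isoOfEquivZero (Equiv.sigmaAssoc fun t s => ((x.lbl t).lbl s).set.carrier))
    fun _ => Equiv.ext fun _ => rfl

section Pull

variable {E : Type u₁} [Category.{v₁} E] {F : Type u₂} [Category.{v₂} F]

/-- An object of the wreath product `E ≀ F`, where `p : E ⥤ Σ_*` assigns to each object of `E` its
set of leaves: an object of `E` whose leaves are decorated by objects of `F`. -/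
structure Pull (p : E ⥤ FinBij) (F : Type u₂) : Type (max u₁ u₂) where
  /-- the object of `E` -/
  tree : E
  /-- the decorations of the leaves -/
  lbl : (p.obj tree).carrier → F

/-- The leaves with their decorations. -/
def Pull.wreath {p : E ⥤ FinBij} (x : Pull p F) : Wreath F := ⟨p.obj x.tree, x.lbl⟩

/-- A morphism of `E ≀ F`: a morphism of `E` and compatible morphisms of the decorations. -/
@[ext]
structure Pull.Hom {p : E ⥤ FinBij} (x y : Pull p F) : Type (max v₁ v₂) where
  /-- the morphism of `E` -/
  tree : x.tree ⟶ y.tree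
  /-- the morphism of decorated leaves -/
  leaf : x.wreath ⟶ y.wreath
  /-- compatibility on leaves -/
  comm : leaf.σ = p.map tree

instance (p : E ⥤ FinBij) : Category.{max v₁ v₂} (Pull p F) where
  Hom := Pull.Hom
  id x := ⟨𝟙 _, 𝟙 _, (p.map_id x.tree).symm⟩
  comp f g := ⟨f.tree ≫ g.tree, f.leaf ≫ g.leaf, by
    rw [p.map_comp, ← f.comm, ← g.comm]; rfl⟩
  id_comp _ := Pull.Hom.ext (Category.id_comp _) (Category.id_comp _)
  comp_id _ := Pull.Hom.ext (Category.comp_id _) (Category.comp_id _)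
  assoc _ _ _ := Pull.Hom.ext (Category.assoc _ _ _) (Category.assoc _ _ _)

/-- Forgetting the decorations. -/
def Pull.fst (p : E ⥤ FinBij) (F : Type u₂) [Category.{v₂} F] : Pull p F ⥤ E where
  obj x := x.tree
  map f := f.tree

/-- The decorated set of leaves. -/
def Pull.snd (p : E ⥤ FinBij) (F : Type u₂) [Category.{v₂} F] : Pull p F ⥤ Wreath F where
  obj x := x.wreath
  map f := f.leaf

/-- The decorated set of leaves is the set of leaves of the tree. -/
def Pull.sq (p : E ⥤ FinBij) (F : Type u₂) [Category.{v₂} F] :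
    Pull.snd p F ⋙ Wreath.forget F ≅ Pull.fst p F ⋙ p :=
  NatIso.ofComponents (fun x => Iso.refl (p.obj x.tree)) fun f =>
    (Category.comp_id _).trans (f.comm.trans (Category.id_comp _).symm)

end Pull

section Small

variable {E : Type u₁} [Category.{0} E] [EssentiallySmall.{0} E]
  {F : Type u₂} [Category.{0} F] [EssentiallySmall.{0} F]

/-- A bijection covered by isomorphisms of decorations is an isomorphism. -/
def wreathIso {x y : Wreath F} (e : x.idx.carrier ≃ y.idx.carrier)
    (i : ∀ s, x.lbl s ≅ y.lbl (e s)) : x ≅ y where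
  hom := ⟨e, fun s => (i s).hom⟩
  inv := ⟨e.symm, fun t => eqToHom (congrArg y.lbl (e.apply_symm_apply t).symm) ≫
    (i (e.symm t)).inv⟩
  hom_inv_id := Wreath.Hom.ext' (fun s => e.symm_apply_apply s) fun s => by
    have key : ∀ (s' : x.idx.carrier) (h : s' = s) (h₁ : y.lbl (e s) = y.lbl (e s'))
        (h₂ : x.lbl s' = x.lbl s),
        ((i s).hom ≫ eqToHom h₁ ≫ (i s').inv) ≫ eqToHom h₂ = 𝟙 _ := by
      rintro s' rfl h₁ h₂
      simp
    exact key _ (e.symm_apply_apply s) _ _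
  inv_hom_id := Wreath.Hom.ext' (fun t => e.apply_symm_apply t) fun t => by
    have key : ∀ (s : x.idx.carrier) (h₁ : y.lbl t = y.lbl (e s)) (h₂ : y.lbl (e s) = y.lbl t),
        ((eqToHom h₁ ≫ (i s).inv) ≫ (i s).hom) ≫ eqToHom h₂ = 𝟙 _ := by
      intro s h₁ h₂
      simp
    exact key _ _ _

instance : EssentiallySmall.{0} (Wreath F) := by
  refine (essentiallySmall_iff _).2 ⟨small_of_surjective (α := Σ n : ℕ, (Fin n → Skeleton F))
    (f := fun k => toSkeleton (⟨⟨Fin k.1⟩, fun i => (fromSkeleton F).obj (k.2 i)⟩ : Wreath F))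
      fun X => ?_, inferInstance⟩
  obtain ⟨S, rfl⟩ := Quotient.exists_rep X
  obtain ⟨n, ⟨e⟩⟩ := Finite.exists_equiv_fin S.idx.carrier
  exact ⟨⟨n, fun i => toSkeleton (S.lbl (e.symm i))⟩, Quotient.sound
    ⟨wreathIso e.symm fun i => fromSkeletonToSkeletonIso _⟩⟩

/-- Isomorphisms of `E ≀ F` from isomorphisms of the two components. -/
def pullIso {p : E ⥤ FinBij} {x y : Pull p F} (i : x.tree ≅ y.tree) (w : x.wreath ≅ y.wreath)
    (h : w.hom.σ = p.map i.hom) : x ≅ y where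
  hom := ⟨i.hom, w.hom, h⟩
  inv := ⟨i.inv, w.inv, by
    have h₁ : ((Wreath.forget F).mapIso w).hom = (p.mapIso i).hom := h
    exact congrArg Iso.inv (Iso.ext h₁)⟩
  hom_inv_id := Pull.Hom.ext i.hom_inv_id w.hom_inv_id
  inv_hom_id := Pull.Hom.ext i.inv_hom_id w.inv_hom_id

instance (p : E ⥤ FinBij) : EssentiallySmall.{0} (Pull p F) := by
  refine (essentiallySmall_iff _).2 ⟨small_of_surjective
    (α := Σ k : Skeleton E, ((p.obj ((fromSkeleton E).obj k)).carrier → Skeleton F))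
    (f := fun k => toSkeleton
      (⟨(fromSkeleton E).obj k.1, fun i => (fromSkeleton F).obj (k.2 i)⟩ : Pull p F))
      fun X => ?_, inferInstance⟩
  obtain ⟨S, rfl⟩ := Quotient.exists_rep X
  let i := fromSkeletonToSkeletonIso S.tree
  let e : (p.obj ((fromSkeleton E).obj (toSkeleton S.tree))).carrier ≃ (p.obj S.tree).carrier :=
    p.map i.hom
  exact ⟨⟨toSkeleton S.tree, fun s => toSkeleton (S.lbl (e s))⟩, Quotient.sound
    ⟨pullIso i (wreathIso e fun s => fromSkeletonToSkeletonIso _) rfl⟩⟩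

end Small

section Cells

variable {C : Type u} [Category.{v} C]

/-- A functor `Y : E ⥤ C` out of a category of trees, together with the functor `p` which
contracts a tree to its set of leaves and along which right Kan extensions are taken. -/
structure Cell (𝔹 : Base) (C : Type u) [Category.{v} C] where
  /-- the category of trees -/
  E : Type 1
  [cat : Category.{0} E]
  [small : EssentiallySmall.{0} E]
  /-- the set of leaves of a tree -/
  p : E ⥤ 𝔹.B
  /-- the functor to extend -/
  Y : E ⥤ C

attribute [instance] Cell.cat Cell.small

namespace Cell

variable {𝔹 : Base}

instance (𝒳 : Cell 𝔹 C) [HasLimitsOfSize.{0, 0} C] : 𝒳.p.HasRightKanExtension 𝒳.Y := by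
  have : ∀ b, HasLimitsOfShape (StructuredArrow b 𝒳.p) C := fun b =>
    hasLimitsOfShape_of_essentiallySmall.{0} _ _
  infer_instance

/-- The right Kan extension of `Y` along `p`. -/
noncomputable def hat [HasLimitsOfSize.{0, 0} C] (𝒳 : Cell 𝔹 C) : 𝔹.B ⥤ C :=
  𝒳.p.rightKanExtension 𝒳.Y

/-- The universal transformation `ι`. -/
noncomputable def ι [HasLimitsOfSize.{0, 0} C] (𝒳 : Cell 𝔹 C) : 𝒳.p ⋙ 𝒳.hat ⟶ 𝒳.Y :=
  𝒳.p.rightKanExtensionCounit 𝒳.Y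

/-- The transformation of functors over `𝔹.B` induced by a transformation over the trees. -/
noncomputable def lift [HasLimitsOfSize.{0, 0} C] (𝒳 : Cell 𝔹 C) {G : 𝔹.B ⥤ C}
    (α : 𝒳.p ⋙ G ⟶ 𝒳.Y) : G ⟶ 𝒳.hat :=
  (𝒳.p.rightKanExtension 𝒳.Y).liftOfIsRightKanExtension
    (𝒳.p.rightKanExtensionCounit 𝒳.Y) G α

/-- A functor `q` between categories of trees which preserves leaves (this is `θ`), together with a
transformation `τ : 𝒳.Y q ⟶ 𝒴.Y`. -/
structure Hom (𝒳 𝒴 : Cell 𝔹 C) where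
  /-- the functor on trees -/
  q : 𝒴.E ⥤ 𝒳.E
  /-- preservation of leaves -/
  θ : q ⋙ 𝒳.p ≅ 𝒴.p
  /-- the transformation -/
  τ : q ⋙ 𝒳.Y ⟶ 𝒴.Y

/-- The identity. -/
def Hom.id (𝒳 : Cell 𝔹 C) : Hom 𝒳 𝒳 := ⟨𝟭 _, 𝒳.p.leftUnitor, 𝒳.Y.leftUnitor.hom⟩

/-- Composition. -/
def Hom.comp {𝒳 𝒴 𝒵 : Cell 𝔹 C} (h : Hom 𝒳 𝒴) (k : Hom 𝒴 𝒵) : Hom 𝒳 𝒵 where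
  q := k.q ⋙ h.q
  θ := Functor.associator _ _ _ ≪≫ Functor.isoWhiskerLeft k.q h.θ ≪≫ k.θ
  τ := (Functor.associator _ _ _).hom ≫ Functor.whiskerLeft k.q h.τ ≫ k.τ

/-- Restriction of a transformation `α : G p ⟶ 𝒳.Y` along `q`, followed by `τ`. -/
def Hom.push {𝒳 𝒴 : Cell 𝔹 C} (h : Hom 𝒳 𝒴) {G : 𝔹.B ⥤ C} (α : 𝒳.p ⋙ G ⟶ 𝒳.Y) :
    𝒴.p ⋙ G ⟶ 𝒴.Y :=
  Functor.whiskerRight h.θ.inv G ≫ (Functor.associator _ _ _).hom ≫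
    Functor.whiskerLeft h.q α ≫ h.τ

/-- The induced transformation of right Kan extensions. -/
noncomputable def Hom.hat [HasLimitsOfSize.{0, 0} C] {𝒳 𝒴 : Cell 𝔹 C} (h : Hom 𝒳 𝒴) :
    𝒳.hat ⟶ 𝒴.hat :=
  𝒴.lift (h.push 𝒳.ι)

/-- A functor over `𝔹.B`, as a functor on trees of level one. -/
def base (M : 𝔹.B ⥤ C) : Cell 𝔹 C where
  E := 𝔹.B
  p := 𝟭 _
  Y := M

/-- A transformation, as a morphism of functors on trees of level one. -/
def Hom.base {M N : 𝔹.B ⥤ C} (f : M ⟶ N) : Hom (Cell.base M) (Cell.base N) :=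
  ⟨𝟭 _, (𝟭 _).leftUnitor, M.leftUnitor.hom ≫ f⟩

/-- A transformation `G p ⟶ 𝒳.Y`, as a morphism. -/
def Hom.ofTrans {G : 𝔹.B ⥤ C} {𝒳 : Cell 𝔹 C} (α : 𝒳.p ⋙ G ⟶ 𝒳.Y) : Hom (Cell.base G) 𝒳 :=
  ⟨𝒳.p, 𝒳.p.rightUnitor, α⟩

variable [MonoidalCategory C] [SymmetricCategory C]

/-- The functor `A ⊚ 𝒴 : Σ_* ≀ E ⥤ C`, which takes a set `T` decorated by trees `t_s` to
`A(T) ⊗ ⨂ s, 𝒴(t_s)`. -/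
noncomputable def circ (A : FinBij ⥤ C) (𝒴 : Cell 𝔹 C) : Cell 𝔹 C where
  E := Wreath 𝒴.E
  p := Wreath.map 𝒴.p ⋙ 𝔹.act
  Y := (Wreath.forget 𝒴.E ⋙ A) ⊗ (Wreath.map 𝒴.Y ⋙ bigTensor C)

/-- Functoriality of `⊚`. -/
noncomputable def Hom.circ {A A' : FinBij ⥤ C} (f : A ⟶ A') {𝒴 𝒴' : Cell 𝔹 C} (h : Hom 𝒴 𝒴') :
    Hom (Cell.circ A 𝒴) (Cell.circ A' 𝒴') where
  q := Wreath.map h.q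
  θ := Functor.isoWhiskerRight (Wreath.mapNatIso h.θ) 𝔹.act
  τ := Functor.whiskerLeft (Wreath.forget 𝒴'.E) f ⊗ₘ
    Functor.whiskerRight (Wreath.mapNat h.τ) (bigTensor C)

/-- The functor `𝒳 ⊚ 𝒴 : E ≀ F ⥤ C`, which takes a tree `t` with leaves decorated by trees `t_s`
to `𝒳(t) ⊗ ⨂ s, 𝒴(t_s)`. -/
noncomputable def odot (𝒳 : Cell Base.sigma C) (𝒴 : Cell 𝔹 C) : Cell 𝔹 C where
  E := Pull 𝒳.p 𝒴.E
  p := Pull.snd 𝒳.p 𝒴.E ⋙ Wreath.map 𝒴.p ⋙ 𝔹.act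
  Y := (Pull.fst 𝒳.p 𝒴.E ⋙ 𝒳.Y) ⊗ (Pull.snd 𝒳.p 𝒴.E ⋙ Wreath.map 𝒴.Y ⋙ bigTensor C)

/-- The morphism `R ⊚ 𝒴 ⟶ 𝒳 ⊚ 𝒴` given by a transformation `R p ⟶ 𝒳.Y`. -/
noncomputable def split {R : FinBij ⥤ C} {𝒳 : Cell Base.sigma C} (ρ : 𝒳.p ⋙ R ⟶ 𝒳.Y)
    (𝒴 : Cell 𝔹 C) : Hom (circ R 𝒴) (odot 𝒳 𝒴) where
  q := Pull.snd 𝒳.p 𝒴.E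
  θ := Iso.refl _
  τ := ((Functor.whiskerRight (Pull.sq 𝒳.p 𝒴.E).hom R ≫
      Functor.whiskerLeft (Pull.fst 𝒳.p 𝒴.E) ρ) ⊗ₘ
    𝟙 (Pull.snd 𝒳.p 𝒴.E ⋙ Wreath.map 𝒴.Y ⋙ bigTensor C) :)

/-- The identification of `A ⊚ 𝒴`, for `A` seen as a functor on trees of level one, with `A ⊚ 𝒴`. -/
noncomputable def collapse (A : FinBij ⥤ C) (𝒴 : Cell 𝔹 C) :
    Hom (odot (base (𝔹 := Base.sigma) A) 𝒴) (circ A 𝒴) where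
  q := { obj := fun x => ⟨x.idx, x.lbl⟩
         map := fun f => ⟨f.σ, f, rfl⟩ }
  θ := Iso.refl _
  τ := 𝟙 _

/-- The associativity `(A ⊚ 𝒳) ⊚ 𝒴 ⟶ A ⊚ (𝒳 ⊚ 𝒴)` of `⊚`. -/
noncomputable def assoc (A : FinBij ⥤ C) (𝒳 : Cell Base.sigma C) (𝒴 : Cell 𝔹 C) :
    Hom (odot (circ A 𝒳) 𝒴) (circ A (odot 𝒳 𝒴)) where
  q := { obj := fun x => ⟨⟨x.idx, fun t => (x.lbl t).tree⟩, fun s => (x.lbl s.1).lbl s.2⟩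
         map := fun f => ⟨⟨f.σ, fun t => (f.φ t).tree⟩,
           (Wreath.mu 𝒴.E).map ((Wreath.map (Pull.snd 𝒳.p 𝒴.E)).map f),
           congrArg (Equiv.sigmaCongr f.σ) (funext fun t => (f.φ t).comm)⟩
         map_id := fun x => Pull.Hom.ext (by rfl)
           ((Wreath.map (Pull.snd 𝒳.p 𝒴.E) ⋙ Wreath.mu 𝒴.E).map_id x)
         map_comp := fun f g => Pull.Hom.ext (by rfl)
           ((Wreath.map (Pull.snd 𝒳.p 𝒴.E) ⋙ Wreath.mu 𝒴.E).map_comp f g) }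
  θ := Functor.isoWhiskerLeft
    (Wreath.map (Pull.snd 𝒳.p 𝒴.E) ⋙ Wreath.map (Wreath.map 𝒴.p)) 𝔹.assocIso
  τ := ((α_ (Wreath.forget (Pull 𝒳.p 𝒴.E) ⋙ A)
      (Wreath.map (Pull.fst 𝒳.p 𝒴.E ⋙ 𝒳.Y) ⋙ bigTensor C)
      (Wreath.map (Pull.snd 𝒳.p 𝒴.E ⋙ Wreath.map 𝒴.Y) ⋙ Wreath.mu C ⋙ bigTensor C)).hom ≫
    ((Wreath.forget (Pull 𝒳.p 𝒴.E) ⋙ A) ◁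
      distr (Pull.fst 𝒳.p 𝒴.E ⋙ 𝒳.Y) (Pull.snd 𝒳.p 𝒴.E ⋙ Wreath.map 𝒴.Y)) :)

end Cell
end Cells

section Cooperads

variable {C : Type u} [Category.{v} C] [MonoidalCategory C] [SymmetricCategory C]

lemma enum_punit : enum PUnit.{1} = [PUnit.unit] :=
  List.perm_singleton.1 ((List.perm_ext_iff_of_nodup (enum_nodup _) (List.nodup_singleton _)).2
    fun _ => ⟨fun _ => List.mem_singleton.2 rfl, fun _ => mem_enum _⟩)

/-- A tensor product with one factor `a` is `a`. -/
noncomputable def unitTensor (a : C) : (bigTensor C).obj (Wreath.unit a) ⟶ a :=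
  eqToHom (congrArg (tl fun _ : PUnit.{1} => a) enum_punit) ≫ (ρ_ a).hom

/-- A tensor product of units is the unit. -/
noncomputable def tensorUnits {S : Type} {X : S → C} (f : ∀ s, X s ⟶ 𝟙_ C) :
    ∀ l : List S, tl X l ⟶ 𝟙_ C
  | [] => 𝟙 _
  | s :: l => (f s ⊗ₘ tensorUnits f l) ≫ (λ_ (𝟙_ C)).hom

lemma FinBij.card_eq {S T : FinBij} (f : S ⟶ T) : Nat.card S.carrier = Nat.card T.carrier :=
  Nat.card_congr f

variable (C) in
open Classical in
/-- The counit symmetric sequence: the unit object on one-element sets and the terminal object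
on all other sets. -/
noncomputable def counitSeq [HasTerminal C] : FinBij ⥤ C where
  obj T := if Nat.card T.carrier = 1 then 𝟙_ C else ⊤_ C
  map f := eqToHom (by rw [FinBij.card_eq f])

/-- The value of the counit symmetric sequence on a one-element set. -/
noncomputable def counitSeqUnit [HasTerminal C] : (counitSeq C).obj ⟨PUnit⟩ ⟶ 𝟙_ C :=
  eqToHom (if_pos Nat.card_unique)

open Cell

/-- The transformation which applies `Δ` to the first factor of `A ⊚ 𝒴`. -/
noncomputable def coface {A : FinBij ⥤ C}
    (Δ : (circ A (base (𝔹 := Base.sigma) A)).p ⋙ A ⟶ (circ A (base (𝔹 := Base.sigma) A)).Y)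
    {𝔹 : Base} (𝒴 : Cell 𝔹 C) : Hom (circ A 𝒴) (circ A (circ A 𝒴)) :=
  ((split Δ 𝒴).comp (assoc A (base (𝔹 := Base.sigma) A) 𝒴)).comp
    (Hom.circ (𝟙 A) (collapse A 𝒴))

/-- The composite `M(b) ⟶ A(⋆) ⊗ M(b) ⟶ 𝟙(⋆) ⊗ M(b) ⟶ M(b)` of a cocomposition with the counit
of `A`. -/
noncomputable def counitLeft [HasTerminal C] {A : FinBij ⥤ C} (ε : A ⟶ counitSeq C) {𝔹 : Base}
    {M : 𝔹.B ⥤ C} (Δ : (circ A (base M)).p ⋙ M ⟶ (circ A (base M)).Y) (b : 𝔹.B) :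
    M.obj b ⟶ M.obj b :=
  M.map (𝔹.unitIso b).inv ≫ Δ.app (Wreath.unit b) ≫
    ((ε.app ⟨PUnit⟩ ≫ counitSeqUnit) ⊗ₘ unitTensor (M.obj b)) ≫ (λ_ (M.obj b)).hom

/-- The composite `A(S) ⟶ A(S) ⊗ ⨂ s, A(⋆) ⟶ A(S) ⊗ ⨂ s, 𝟙(⋆) ⟶ A(S)`. -/
noncomputable def counitRight [HasTerminal C] {A : FinBij ⥤ C} (ε : A ⟶ counitSeq C)
    (Δ : (circ A (base (𝔹 := Base.sigma) A)).p ⋙ A ⟶ (circ A (base (𝔹 := Base.sigma) A)).Y)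
    (S : FinBij) : A.obj S ⟶ A.obj S :=
  A.map (isoOfEquiv (T := ⟨Σ _ : S.carrier, PUnit⟩) (Equiv.sigmaPUnit S.carrier).symm).hom ≫
    Δ.app ⟨S, fun _ => ⟨PUnit⟩⟩ ≫
    (A.obj S ◁ tensorUnits (fun _ => ε.app ⟨PUnit⟩ ≫ counitSeqUnit) (enum S.carrier)) ≫
    (ρ_ (A.obj S)).hom

variable (C) in
/-- A counital cooperad `(A, Δ, ε)`. -/
structure Cooperad [HasTerminal C] where
  /-- the symmetric sequence -/
  A : FinBij ⥤ C
  /-- the cocomposition `A γ² ⟶ A ⊚ A` -/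
  Δ : (circ A (base (𝔹 := Base.sigma) A)).p ⋙ A ⟶ (circ A (base (𝔹 := Base.sigma) A)).Y
  /-- the counit -/
  ε : A ⟶ counitSeq C
  coassoc : (coface Δ (base (𝔹 := Base.sigma) A)).push Δ =
    (Hom.circ (𝟙 A) (Hom.ofTrans Δ)).push Δ
  counit_left S : counitLeft (𝔹 := Base.sigma) ε Δ S = 𝟙 _
  counit_right S : counitRight ε Δ S = 𝟙 _

/-- A comodule `(M, Δ_M)` over a cooperad, where `M` is a functor on `Σ_*` or on `Σ_0`. -/
structure Comodule [HasTerminal C] (O : Cooperad C) (𝔹 : Base) where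
  /-- the functor -/
  M : 𝔹.B ⥤ C
  /-- the cocomposition `M γ² ⟶ O ⊚ M` -/
  Δ : (circ O.A (base M)).p ⋙ M ⟶ (circ O.A (base M)).Y
  coassoc : (coface O.Δ (base M)).push Δ = (Hom.circ (𝟙 O.A) (Hom.ofTrans Δ)).push Δ
  counit_left b : counitLeft O.ε Δ b = 𝟙 _

/-- A cooperad is a comodule over itself. -/
noncomputable def Cooperad.self [HasTerminal C] (O : Cooperad C) : Comodule O Base.sigma :=
  ⟨O.A, O.Δ, O.coassoc, O.counit_left⟩

end Cooperads

section Expressions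

open Cell

mutual

/-- A parenthesized composition product of copies of a cooperad `O` and a final comodule `M`. -/
inductive Expr
  /-- `O`, or `M` in the last position -/
  | atom : Expr
  /-- the composition product `(e ∘̂ w₁ ∘̂ ⋯ ∘̂ wₖ)` -/
  | node : Expr → Word → Expr

/-- The sequence `w₁ ∘̂ ⋯ ∘̂ wₖ` of the factors of a composition product, `k ≥ 1`. -/
inductive Word
  /-- a single factor -/
  | single : Expr → Word
  /-- one factor followed by others -/
  | cons : Expr → Word → Word

end

/-- Concatenation of sequences of factors. -/
def Word.append : Word → Word → Word
  | .single e, w => .cons e w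
  | .cons e v, w => .cons e (v.append w)

/-- The `k + 1` factors `O, …, O, M`. -/
def Word.flat : ℕ → Word
  | 0 => .single .atom
  | k + 1 => .cons .atom (Word.flat k)

/-- The expression `O^{∘̂ k} ∘̂ M` without inner parentheses; it is `M` for `k = 0`. -/
def Expr.flat : ℕ → Expr
  | 0 => .atom
  | k + 1 => .node .atom (Word.flat k)

variable {C : Type u} [Category.{v} C] [MonoidalCategory C] [SymmetricCategory C]
  [HasLimitsOfSize.{0, 0} C]

mutual

/-- The value of an expression, lifted to a larger universe. -/
noncomputable def Expr.evalAux (A : FinBij ⥤ C) :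
    Expr → ∀ {𝔹 : Base}, (𝔹.B ⥤ C) → ULift.{2} (𝔹.B ⥤ C)
  | .atom, _, M => ⟨M⟩
  | .node e w, _, M => ⟨(circ (e.evalAux A (𝔹 := Base.sigma) A).down (w.cell A M)).hat⟩

/-- The functor `w₁ ⊚ ⋯ ⊚ wₖ` on trees of level `k`. -/
noncomputable def Word.cell (A : FinBij ⥤ C) : Word → ∀ {𝔹 : Base}, (𝔹.B ⥤ C) → Cell 𝔹 C
  | .single e, _, M => base (e.evalAux A M).down
  | .cons e w, _, M => circ (e.evalAux A (𝔹 := Base.sigma) A).down (w.cell A M)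

end

/-- The value of an expression: `atom` is `M`, and `e ∘̂ w₁ ∘̂ ⋯ ∘̂ wₖ` is the right Kan extension
of `e ⊚ w₁ ⊚ ⋯ ⊚ wₖ`. All factors but the last are formed from `A`, the last one from `M`. -/
noncomputable def Expr.eval (A : FinBij ⥤ C) (e : Expr) {𝔹 : Base} (M : 𝔹.B ⥤ C) : 𝔹.B ⥤ C :=
  (e.evalAux A M).down

/-- The associativity `(w'₁ ⊚ ⋯ ⊚ w'ⱼ) ⊚ (w₁ ⊚ ⋯ ⊚ wₖ) ⟶ w'₁ ⊚ ⋯ ⊚ w'ⱼ ⊚ w₁ ⊚ ⋯ ⊚ wₖ` of `⊚`. -/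
noncomputable def flatten (A : FinBij ⥤ C) {𝔹 : Base} (M : 𝔹.B ⥤ C) : (w' w : Word) →
    Hom (odot (w'.cell A (𝔹 := Base.sigma) A) (w.cell A M)) ((w'.append w).cell A M)
  | .single e, w => collapse (e.eval A (𝔹 := Base.sigma) A) (w.cell A M)
  | .cons e v, w => (assoc (e.eval A (𝔹 := Base.sigma) A) (v.cell A (𝔹 := Base.sigma) A)
      (w.cell A M)).comp (Hom.circ (𝟙 _) (flatten A M v w))

mutual

/-- `EMap X e e' f`: the transformation `f` from the value of `e` to the value of `e'` is a
combination of parenthesization maps and cocomposition maps of `O` and of the comodule `X`. -/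
inductive EMap {O : Cooperad C} : {𝔹 : Base} → (X : Comodule O 𝔹) → (e e' : Expr) →
    (e.eval O.A X.M ⟶ e'.eval O.A X.M) → Prop
  | id {𝔹 : Base} (X : Comodule O 𝔹) (e : Expr) : EMap X e e (𝟙 _)
  | comp {𝔹 : Base} (X : Comodule O 𝔹) {e e' e'' : Expr}
      {f : e.eval O.A X.M ⟶ e'.eval O.A X.M} {g : e'.eval O.A X.M ⟶ e''.eval O.A X.M} :
      EMap X e e' f → EMap X e' e'' g → EMap X e e'' (f ≫ g)
  /-- the cocomposition `Δ_X : X ⟶ O ∘̂ X` -/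
  | cocomp {𝔹 : Base} (X : Comodule O 𝔹) :
      EMap X .atom (.node .atom (.single .atom)) ((circ O.A (base X.M)).lift X.Δ)
  /-- right Kan extension of a transformation on trees -/
  | kan {𝔹 : Base} (X : Comodule O 𝔹) {e e' : Expr} {w w' : Word}
      {h : Hom ((Word.cons e w).cell O.A X.M) ((Word.cons e' w').cell O.A X.M)} :
      WMap X (.cons e w) (.cons e' w') h → EMap X (.node e w) (.node e' w') h.hat

/-- The transformations on trees whose right Kan extensions are the parenthesization and
cocomposition maps, applied to the factors of a composition product. -/
inductive WMap {O : Cooperad C} : {𝔹 : Base} → (X : Comodule O 𝔹) → (w w' : Word) →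
    Hom (w.cell O.A X.M) (w'.cell O.A X.M) → Prop
  | id {𝔹 : Base} (X : Comodule O 𝔹) (w : Word) : WMap X w w (Hom.id _)
  /-- a combination of maps applied to the last factor -/
  | single {𝔹 : Base} (X : Comodule O 𝔹) {e e' : Expr}
      {f : e.eval O.A X.M ⟶ e'.eval O.A X.M} :
      EMap X e e' f → WMap X (.single e) (.single e') (Hom.base f)
  /-- functoriality of `⊚` -/
  | cons {𝔹 : Base} (X : Comodule O 𝔹) {e e' : Expr} {w w' : Word}
      {f : e.eval O.A O.self.M ⟶ e'.eval O.A O.self.M}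
      {h : Hom (w.cell O.A X.M) (w'.cell O.A X.M)} :
      EMap O.self e e' f → WMap X w w' h → WMap X (.cons e w) (.cons e' w') (Hom.circ f h)
  /-- the removal of the parentheses in `(e ∘̂ w'₁ ∘̂ ⋯ ∘̂ w'ⱼ) ⊚ w₁ ⊚ ⋯ ⊚ wₖ` -/
  | paren {𝔹 : Base} (X : Comodule O 𝔹) (e : Expr) (w' w : Word) :
      WMap X (.cons (.node e w') w) (.cons e (w'.append w))
        ((split (circ (e.eval O.A (𝔹 := Base.sigma) O.A)
          (w'.cell O.A (𝔹 := Base.sigma) O.A)).ι (w.cell O.A X.M)).comp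
            (flatten O.A X.M (.cons e w') w))
  /-- the removal of the parentheses of the last factor `(e ∘̂ w₁ ∘̂ ⋯ ∘̂ wₖ)` -/
  | parenLast {𝔹 : Base} (X : Comodule O 𝔹) (e : Expr) (w : Word) :
      WMap X (.single (.node e w)) (.cons e w)
        (Hom.ofTrans (circ (e.eval O.A (𝔹 := Base.sigma) O.A) (w.cell O.A X.M)).ι)
  /-- cocomposition on a factor `O` -/
  | coface {𝔹 : Base} (X : Comodule O 𝔹) (w : Word) :
      WMap X (.cons .atom w) (.cons .atom (.cons .atom w)) (coface O.Δ (w.cell O.A X.M))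
  /-- cocomposition on the last factor -/
  | cofaceLast {𝔹 : Base} (X : Comodule O 𝔹) :
      WMap X (.single .atom) (.cons .atom (.single .atom)) (Hom.ofTrans X.Δ)

end

/-- A coalgebra `(c, Δ_c)` over a cooperad. -/
structure Coalgebra (O : Cooperad C) where
  /-- the object -/
  c : C
  /-- the cocomposition `c γ² ⟶ O ⊚ c` -/
  Δ : (circ O.A (base (𝔹 := Base.zero) ((Functor.const EmptyBij).obj c))).p ⋙
      (Functor.const EmptyBij).obj c ⟶
    (circ O.A (base (𝔹 := Base.zero) ((Functor.const EmptyBij).obj c))).Y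
  coassoc : (coface O.Δ (base (𝔹 := Base.zero) ((Functor.const EmptyBij).obj c))).push Δ =
    (Hom.circ (𝟙 O.A) (Hom.ofTrans Δ)).push Δ
  counit_left b : counitLeft (𝔹 := Base.zero) O.ε Δ b = 𝟙 _

/-- A coalgebra, as a comodule concentrated in arity zero. -/
noncomputable def Coalgebra.toComodule {O : Cooperad C} (c : Coalgebra O) :
    Comodule O Base.zero :=
  ⟨(Functor.const EmptyBij).obj c.c, c.Δ, c.coassoc, c.counit_left⟩

/-- The empty set, as an object of `Σ_0`. -/
def emptySet : EmptyBij := { set := ⟨PEmpty⟩ }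

/-- The object `O^{∘̂ k} ∘̂ c` of `C`. -/
noncomputable def Coalgebra.target {O : Cooperad C} (c : Coalgebra O) (k : ℕ) : C :=
  ((Expr.flat k).eval O.A c.toComodule.M).obj emptySet

end Expressions

end TreeSeq

/-!
Every expression `e` receives a canonical iterated cocomposition `e.coact X` from a comodule `X`,
and every combination `f : e ⟶ e'` is compatible with these: `e.coact X ≫ f = e'.coact X`. It
suffices to check this on trees, before right Kan extension, for the generating maps. There the
removal of parentheses and the cocomposition of an inner factor `O` both reduce to coassociativity,
extended from the trees of level three to `A ⊚ 𝒳 ⊚ 𝒴` by naturality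
(`Comodule.push_assoc_odotTrans`). As the canonical map of `X` to itself is the identity, a
combination from `X` to `e` is equal to `e.coact X`. For existence, cocompose the last factor until
there are as many factors as in the outermost product of `e`, and recurse into each factor.
-/

namespace TreeSeq

/-- The morphism of `Wreath E` with components `φ s` over the identity of the index set `S`; used to
apply the naturality of `distr` to a family of morphisms. -/
def Wreath.homOfFamily {E : Type u₁} [Category.{v₁} E] {S : FinBij} {a b : S.carrier → E}
    (φ : ∀ s, a s ⟶ b s) : (⟨S, a⟩ : Wreath E) ⟶ ⟨S, b⟩ :=
  ⟨Equiv.refl _, φ⟩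

lemma tensorHom_assoc_whiskerLeft {C : Type u} [Category.{v} C] [MonoidalCategory C]
    {a b b' c c' k k' l l' : C} {i : a ⟶ b ⊗ c} {f : b ⟶ b'} {r : c ⟶ c'} {s : k ⟶ k'}
    {d : c ⊗ k ⟶ l} {d' : c' ⊗ k' ⟶ l'} {g : l ⟶ l'} (h : (r ⊗ₘ s) ≫ d' = d ≫ g) :
    ((i ≫ (f ⊗ₘ r)) ⊗ₘ s) ≫ (α_ b' c' k').hom ≫ b' ◁ d' =
      (i ▷ k ≫ (α_ b c k).hom ≫ b ◁ d) ≫ (f ⊗ₘ g) := by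
  simp only [Category.assoc]
  rw [← id_tensorHom, ← id_tensorHom, ← tensorHom_id, tensorHom_comp_tensorHom, Category.id_comp,
    ← h, ← Category.id_comp s, ← tensorHom_comp_tensorHom, Category.assoc,
    associator_naturality_assoc, tensorHom_comp_tensorHom, Category.comp_id, Category.id_comp]

lemma comp_tensorHom_tensorHom {C : Type u} [Category.{v} C] [MonoidalCategory C]
    {x y a₀ a₁ a₂ a₃ b₀ b₁ b₂ b₃ : C} {m : x ⟶ y} {d : x ⟶ a₀ ⊗ b₀} {d' : y ⟶ a₁ ⊗ b₁}
    {a : a₀ ⟶ a₁} {b : b₀ ⟶ b₁} {f : a₁ ⟶ a₂} {φ : b₁ ⟶ b₂} {g : a₂ ⟶ a₃} {ψ : b₂ ⟶ b₃}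
    (h : m ≫ d' = d ≫ (a ⊗ₘ b)) :
    m ≫ (d' ≫ (f ⊗ₘ φ)) ≫ (g ⊗ₘ ψ) = d ≫ ((a ≫ f ≫ g) ⊗ₘ (b ≫ φ ≫ ψ)) := by
  rw [Category.assoc, reassoc_of% h, tensorHom_comp_tensorHom, tensorHom_comp_tensorHom]

section Distr

variable {C : Type u} [Category.{v} C] [MonoidalCategory C] [SymmetricCategory C]

lemma distrApp_natural {T : FinBij} {a b : T.carrier → C} {K L : T.carrier → Wreath C}
    (φ : ∀ t, a t ⟶ b t) (ψ : ∀ t, K t ⟶ L t) :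
    ((bigTensor C).map (Wreath.homOfFamily φ) ⊗ₘ
        (bigTensor C).map ((Wreath.mu C).map (Wreath.homOfFamily ψ))) ≫ distrApp b L =
      distrApp a K ≫
        (bigTensor C).map (Wreath.homOfFamily fun t => φ t ⊗ₘ (bigTensor C).map (ψ t)) :=
  (distr (CategoryTheory.Prod.fst C (Wreath C)) (CategoryTheory.Prod.snd C (Wreath C))).naturality
    (Wreath.homOfFamily (a := fun t => (a t, K t)) (b := fun t => (b t, L t))
      fun t => (φ t, ψ t))

end Distr

namespace Cell

section Push

variable {C : Type u} [Category.{v} C] {𝔹 : Base} {𝒳 𝒴 𝒵 : Cell 𝔹 C} {F G H : 𝔹.B ⥤ C}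

lemma Hom.push_app (h : Hom 𝒳 𝒴) (α : 𝒳.p ⋙ G ⟶ 𝒳.Y) (y : 𝒴.E) :
    (h.push α).app y = G.map (h.θ.inv.app y) ≫ α.app (h.q.obj y) ≫ h.τ.app y :=
  congrArg (_ ≫ ·) (Category.id_comp _)

lemma Hom.push_id (α : 𝒳.p ⋙ G ⟶ 𝒳.Y) : (Hom.id 𝒳).push α = α := by
  ext x
  rw [Hom.push_app]
  exact (congrArg (· ≫ _) (G.map_id _)).trans ((Category.id_comp _).trans (Category.comp_id _))

lemma Hom.push_comp (h : Hom 𝒳 𝒴) (k : Hom 𝒴 𝒵) (α : 𝒳.p ⋙ G ⟶ 𝒳.Y) :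
    (h.comp k).push α = k.push (h.push α) := by
  ext z
  have hθ : (h.comp k).θ.inv.app z = k.θ.inv.app z ≫ h.θ.inv.app (k.q.obj z) := by
    simp [Hom.comp]
  have hτ : (h.comp k).τ.app z = h.τ.app (k.q.obj z) ≫ k.τ.app z := Category.id_comp _
  rw [Hom.push_app, Hom.push_app, Hom.push_app, hθ, hτ, Category.assoc, Category.assoc]
  exact (congrArg (· ≫ _) (G.map_comp _ _)).trans (Category.assoc _ _ _)

/-- A transformation `F ⟶ G` as one into the cell `base G` of trees of level one, whose projection
is the identity functor. -/
def baseTrans (f : F ⟶ G) : (base G).p ⋙ F ⟶ (base G).Y :=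
  F.leftUnitor.hom ≫ f

lemma Hom.push_baseTrans_ofTrans (f : F ⟶ G) (α : 𝒳.p ⋙ G ⟶ 𝒳.Y) :
    (Hom.ofTrans α).push (baseTrans f) = Functor.whiskerLeft 𝒳.p f ≫ α := by
  ext x
  rw [Hom.push_app]
  change F.map (𝟙 _) ≫ (𝟙 _ ≫ f.app _) ≫ α.app x = f.app _ ≫ α.app x
  simp

lemma Hom.push_baseTrans_base (f : F ⟶ G) (g : G ⟶ H) :
    (Hom.base g).push (baseTrans f) = baseTrans (f ≫ g) := by
  refine NatTrans.ext (funext fun b : 𝔹.B => (Hom.push_app _ _ _).trans ?_)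
  change F.map (𝟙 b) ≫ (𝟙 _ ≫ f.app b) ≫ 𝟙 _ ≫ g.app b = 𝟙 _ ≫ f.app b ≫ g.app b
  simp

lemma Hom.push_whiskerLeft (h : Hom 𝒳 𝒴) (f : F ⟶ G) (α : 𝒳.p ⋙ G ⟶ 𝒳.Y) :
    h.push (Functor.whiskerLeft 𝒳.p f ≫ α) = Functor.whiskerLeft 𝒴.p f ≫ h.push α := by
  ext y
  simp [Hom.push_app]

variable [HasLimitsOfSize.{0, 0} C]

lemma whiskerLeft_lift (α : 𝒳.p ⋙ G ⟶ 𝒳.Y) :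
    Functor.whiskerLeft 𝒳.p (𝒳.lift α) ≫ 𝒳.ι = α :=
  Functor.liftOfIsRightKanExtension_fac (𝒳.p.rightKanExtension 𝒳.Y)
    (𝒳.p.rightKanExtensionCounit 𝒳.Y) G α

lemma hat_hom_ext {f g : G ⟶ 𝒳.hat}
    (h : Functor.whiskerLeft 𝒳.p f ≫ 𝒳.ι = Functor.whiskerLeft 𝒳.p g ≫ 𝒳.ι) : f = g :=
  (𝒳.p.rightKanExtension 𝒳.Y).hom_ext_of_isRightKanExtension (𝒳.p.rightKanExtensionCounit 𝒳.Y)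
    f g h

lemma lift_comp_hat (α : 𝒳.p ⋙ G ⟶ 𝒳.Y) (h : Hom 𝒳 𝒴) :
    𝒳.lift α ≫ h.hat = 𝒴.lift (h.push α) := by
  apply hat_hom_ext
  have hh : Functor.whiskerLeft 𝒴.p h.hat ≫ 𝒴.ι = h.push 𝒳.ι := whiskerLeft_lift _
  rw [Functor.whiskerLeft_comp, Category.assoc, hh, ← h.push_whiskerLeft, whiskerLeft_lift,
    whiskerLeft_lift]

end Push

section Products

variable {C : Type u} [Category.{v} C] [MonoidalCategory C] [SymmetricCategory C]
  {A A' A'' : FinBij ⥤ C} {𝔹 : Base} {M N : 𝔹.B ⥤ C}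

/-- The composite `M γ ⟶ A' ⊚ 𝒴` of a cocomposition `Δ : M γ² ⟶ A ⊚ N` with `f : A ⟶ A'` on the
first factor and `α : N γ ⟶ 𝒴` on the second. -/
noncomputable def circTrans (Δ : (circ A (base N)).p ⋙ M ⟶ (circ A (base N)).Y) (f : A ⟶ A')
    {𝒴 : Cell 𝔹 C} (α : 𝒴.p ⋙ N ⟶ 𝒴.Y) : (circ A' 𝒴).p ⋙ M ⟶ (circ A' 𝒴).Y :=
  (Hom.circ f (Hom.ofTrans α)).push Δ

/-- The composite `M γ ⟶ 𝒳 ⊚ 𝒴` of a cocomposition `Δ : M γ² ⟶ A ⊚ N` with `ρ : A γ ⟶ 𝒳` on the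
first factor and `α : N γ ⟶ 𝒴` on the second. -/
noncomputable def odotTrans (Δ : (circ A (base N)).p ⋙ M ⟶ (circ A (base N)).Y)
    {𝒳 : Cell Base.sigma C} (ρ : 𝒳.p ⋙ A ⟶ 𝒳.Y) {𝒴 : Cell 𝔹 C} (α : 𝒴.p ⋙ N ⟶ 𝒴.Y) :
    (odot 𝒳 𝒴).p ⋙ M ⟶ (odot 𝒳 𝒴).Y :=
  (split ρ 𝒴).push (circTrans Δ (𝟙 A) α)

variable (Δ : (circ A (base N)).p ⋙ M ⟶ (circ A (base N)).Y)

-- The values of cells at trees are identified only by unfolding `circ`, `odot` and `base`, which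
-- `rw` does not do; hence the `congrArg` and `Eq.trans` terms here and below.
lemma circTrans_app (f : A ⟶ A') {𝒴 : Cell 𝔹 C} (α : 𝒴.p ⋙ N ⟶ 𝒴.Y) (y : Wreath 𝒴.E) :
    (circTrans Δ f α).app y = Δ.app ((Wreath.map 𝒴.p).obj y) ≫
      (f.app y.idx ⊗ₘ (bigTensor C).map ((Wreath.mapNat α).app y)) := by
  refine (Hom.push_app _ _ _).trans ?_
  have hθ : (Hom.circ f (Hom.ofTrans α)).θ.inv.app y = 𝟙 _ := 𝔹.act.map_id _
  rw [hθ]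
  exact (congrArg (· ≫ _) (M.map_id _)).trans (Category.id_comp _)

lemma push_split_circTrans_app (f : A ⟶ A') {𝒳 : Cell Base.sigma C} (ρ : 𝒳.p ⋙ A' ⟶ 𝒳.Y)
    {𝒴 : Cell 𝔹 C} (α : 𝒴.p ⋙ N ⟶ 𝒴.Y) (x : Pull 𝒳.p 𝒴.E) :
    ((split ρ 𝒴).push (circTrans Δ f α)).app x = Δ.app ((Wreath.map 𝒴.p).obj x.wreath) ≫
      ((f.app (𝒳.p.obj x.tree) ≫ ρ.app x.tree) ⊗ₘ
        (bigTensor C).map ((Wreath.mapNat α).app x.wreath)) := by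
  have hτ : (split ρ 𝒴).τ.app x = ρ.app x.tree ⊗ₘ 𝟙 _ :=
    congrArg (· ⊗ₘ 𝟙 _) ((congrArg (· ≫ _) (A'.map_id _)).trans (Category.id_comp _))
  refine (Hom.push_app _ _ _).trans ((congrArg (· ≫ _) (M.map_id _)).trans ?_)
  rw [hτ]
  refine (Category.id_comp _).trans ((congrArg (· ≫ _) (circTrans_app Δ f α x.wreath)).trans ?_)
  refine (Category.assoc _ _ _).trans (congrArg (_ ≫ ·) ?_)
  exact (tensorHom_comp_tensorHom _ _ _ _).trans (congrArg (_ ⊗ₘ ·) (Category.comp_id _))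

lemma odotTrans_app {𝒳 : Cell Base.sigma C} (ρ : 𝒳.p ⋙ A ⟶ 𝒳.Y) {𝒴 : Cell 𝔹 C}
    (α : 𝒴.p ⋙ N ⟶ 𝒴.Y) (x : Pull 𝒳.p 𝒴.E) :
    (odotTrans Δ ρ α).app x = Δ.app ((Wreath.map 𝒴.p).obj x.wreath) ≫
      (ρ.app x.tree ⊗ₘ (bigTensor C).map ((Wreath.mapNat α).app x.wreath)) :=
  (push_split_circTrans_app Δ (𝟙 A) ρ α x).trans
    (congrArg (fun r => _ ≫ (r ⊗ₘ _)) (Category.id_comp _))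

lemma push_split_circTrans (f : A ⟶ A') {𝒳 : Cell Base.sigma C} (ρ : 𝒳.p ⋙ A' ⟶ 𝒳.Y)
    {𝒴 : Cell 𝔹 C} (α : 𝒴.p ⋙ N ⟶ 𝒴.Y) :
    (split ρ 𝒴).push (circTrans Δ f α) = odotTrans Δ (Functor.whiskerLeft 𝒳.p f ≫ ρ) α :=
  NatTrans.ext (funext fun x : Pull 𝒳.p 𝒴.E =>
    (push_split_circTrans_app Δ f ρ α x).trans
      (odotTrans_app Δ (Functor.whiskerLeft 𝒳.p f ≫ ρ) α x).symm)

lemma push_circ_circTrans (f : A ⟶ A') (g : A' ⟶ A'') {𝒴 𝒵 : Cell 𝔹 C} (α : 𝒴.p ⋙ N ⟶ 𝒴.Y)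
    (h : Hom 𝒴 𝒵) :
    (Hom.circ g h).push (circTrans Δ f α) = circTrans Δ (f ≫ g) (h.push α) := by
  refine NatTrans.ext (funext fun z : Wreath 𝒵.E => (Hom.push_app _ _ _).trans ?_)
  let θ := (Wreath.mapNat h.θ.inv).app z
  have hΔ : M.map (𝔹.act.map θ) ≫ Δ.app ((Wreath.map (h.q ⋙ 𝒴.p)).obj z) =
      Δ.app ((Wreath.map 𝒵.p).obj z) ≫
        (A.map (𝟙 z.idx) ⊗ₘ (bigTensor C).map ((Wreath.map N).map θ)) :=
    Δ.naturality θ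
  have hα : (Wreath.map N).map θ ≫ (Wreath.mapNat α).app ((Wreath.map h.q).obj z) ≫
      (Wreath.mapNat h.τ).app z = (Wreath.mapNat (h.push α)).app z :=
    Wreath.Hom.ext' (fun _ => rfl) fun s =>
      (Category.comp_id _).trans (h.push_app α (z.lbl s)).symm
  refine (congrArg (fun k => _ ≫ k ≫ _) (circTrans_app Δ f α _)).trans
    ((comp_tensorHom_tensorHom hΔ).trans (Eq.trans ?_ (circTrans_app Δ _ _ z).symm))
  refine congrArg (_ ≫ ·) (congrArg₂ (· ⊗ₘ ·) ?_ ?_)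
  · exact (congrArg (· ≫ _) (A.map_id _)).trans (Category.id_comp _)
  · exact (congrArg (_ ≫ ·) ((bigTensor C).map_comp _ _).symm).trans
      (((bigTensor C).map_comp _ _).symm.trans (congrArg (bigTensor C).map hα))

lemma push_collapse_odotTrans (f : A ⟶ A') {𝒴 : Cell 𝔹 C} (α : 𝒴.p ⋙ N ⟶ 𝒴.Y) :
    (collapse A' 𝒴).push (odotTrans Δ (baseTrans (𝔹 := Base.sigma) f) α) = circTrans Δ f α := by
  refine NatTrans.ext (funext fun y : Wreath 𝒴.E => (Hom.push_app _ _ _).trans ?_)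
  refine (congrArg (· ≫ _) (M.map_id _)).trans ((Category.id_comp _).trans ?_)
  refine (Category.comp_id _).trans ((odotTrans_app Δ _ α _).trans ?_)
  refine Eq.trans ?_ (circTrans_app Δ f α y).symm
  exact congrArg (fun k => Δ.app _ ≫ (k ⊗ₘ _)) (Category.id_comp _)

lemma bigTensor_map_mapNat_baseTrans_id (z : Wreath 𝔹.B) :
    (bigTensor C).map ((Wreath.mapNat (baseTrans (𝟙 N))).app z) = 𝟙 _ := by
  have h : (Wreath.mapNat (baseTrans (𝟙 N))).app z = 𝟙 ((Wreath.map N).obj z) :=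
    Wreath.Hom.ext' (fun _ => rfl) fun s =>
      (Category.comp_id _).trans (Category.id_comp (𝟙 (N.obj (z.lbl s))))
  exact (congrArg _ h).trans ((bigTensor C).map_id _)

lemma circTrans_id_baseTrans : circTrans Δ (𝟙 A) (baseTrans (𝟙 N)) = Δ :=
  NatTrans.ext (funext fun z : Wreath 𝔹.B => (circTrans_app Δ _ _ z).trans
    ((congrArg (fun k => _ ≫ (_ ⊗ₘ k)) (bigTensor_map_mapNat_baseTrans_id z)).trans
      ((congrArg (_ ≫ ·) (id_tensorHom_id _ _)).trans (Category.comp_id _))))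

lemma push_assoc_odotTrans_app {𝒳 : Cell Base.sigma C} (ρ : (circ A' 𝒳).p ⋙ A ⟶ (circ A' 𝒳).Y)
    {𝒴 : Cell 𝔹 C} (α : 𝒴.p ⋙ N ⟶ 𝒴.Y) (x : Wreath (Pull 𝒳.p 𝒴.E)) :
    ((assoc A' 𝒳 𝒴).push (odotTrans Δ ρ α)).app x =
      M.map (𝔹.assocIso.inv.app ((Wreath.map (Pull.snd 𝒳.p 𝒴.E ⋙ Wreath.map 𝒴.p)).obj x)) ≫
      Δ.app ((Wreath.mu 𝔹.B).obj ((Wreath.map (Pull.snd 𝒳.p 𝒴.E ⋙ Wreath.map 𝒴.p)).obj x)) ≫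
      (ρ.app ((Wreath.map (Pull.fst 𝒳.p 𝒴.E)).obj x) ⊗ₘ (bigTensor C).map ((Wreath.mapNat α).app
        ((Wreath.mu 𝒴.E).obj ((Wreath.map (Pull.snd 𝒳.p 𝒴.E)).obj x)))) ≫
      (α_ _ _ _).hom ≫ A'.obj x.idx ◁ distrApp (fun t => 𝒳.Y.obj (x.lbl t).tree)
        fun t => (Wreath.map 𝒴.Y).obj (x.lbl t).wreath :=
  (Hom.push_app _ _ _).trans (congrArg (_ ≫ ·)
    ((congrArg (· ≫ _) (odotTrans_app Δ ρ α ((assoc A' 𝒳 𝒴).q.obj x))).trans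
      (Category.assoc _ _ _)))

lemma push_coface_app (Δ' : (circ A (base (𝔹 := Base.sigma) A)).p ⋙ A ⟶
    (circ A (base (𝔹 := Base.sigma) A)).Y) (z : Wreath (Wreath 𝔹.B)) :
    ((coface Δ' (base N)).push Δ).app z =
      M.map (𝔹.assocIso.inv.app z) ≫ Δ.app ((Wreath.mu 𝔹.B).obj z) ≫
      Δ'.app ((Wreath.map (Wreath.forget 𝔹.B)).obj z) ▷ _ ≫ (α_ _ _ _).hom ≫
      A.obj z.idx ◁ distrApp (fun t => A.obj (z.lbl t).idx)
        fun t => (Wreath.map N).obj (z.lbl t) := by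
  have hsplit : (split Δ' (base N)).push Δ = odotTrans Δ Δ' (baseTrans (𝟙 N)) :=
    congrArg _ (circTrans_id_baseTrans Δ).symm
  have hθ : (Hom.circ (𝟙 A) (collapse A (base N))).θ.inv.app z = 𝟙 _ := 𝔹.act.map_id _
  have hτ : (Hom.circ (𝟙 A) (collapse A (base N))).τ.app z = 𝟙 _ :=
    (congrArg (_ ⊗ₘ ·) ((bigTensor C).map_id _)).trans (id_tensorHom_id _ _)
  rw [coface, Hom.push_comp, Hom.push_comp, hsplit]
  refine (Hom.push_app _ _ _).trans ?_
  rw [hθ, hτ]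
  refine (congrArg (· ≫ _) (M.map_id _)).trans ((Category.id_comp _).trans ?_)
  refine (Category.comp_id _).trans ((push_assoc_odotTrans_app Δ _ _ _).trans ?_)
  refine congrArg (fun k => _ ≫ _ ≫ k ≫ _) ?_
  exact (congrArg (_ ⊗ₘ ·) (bigTensor_map_mapNat_baseTrans_id _)).trans (tensorHom_id _ _)

end Products

end Cell

open Cell

section Coassociativity

variable {C : Type u} [Category.{v} C] [MonoidalCategory C] [SymmetricCategory C] [HasTerminal C]
  {O : Cooperad C} {𝔹 : Base} (X : Comodule O 𝔹)

lemma Comodule.coassoc_app (z : Wreath (Wreath 𝔹.B)) :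
    X.M.map (𝔹.assocIso.inv.app z) ≫ X.Δ.app ((Wreath.mu 𝔹.B).obj z) ≫
      O.Δ.app ((Wreath.map (Wreath.forget 𝔹.B)).obj z) ▷ _ ≫ (α_ _ _ _).hom ≫
      O.A.obj z.idx ◁ distrApp (fun t => O.A.obj (z.lbl t).idx)
        (fun t => (Wreath.map X.M).obj (z.lbl t)) =
    X.Δ.app ((Wreath.map 𝔹.act).obj z) ≫
      O.A.obj z.idx ◁ (bigTensor C).map ((Wreath.mapNat X.Δ).app z) :=
  (push_coface_app X.Δ O.Δ z).symm.trans ((congr_app X.coassoc z).trans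
    ((circTrans_app X.Δ (𝟙 O.A) X.Δ z).trans (congrArg (_ ≫ ·) (id_tensorHom _ _))))

theorem Comodule.push_assoc_odotTrans {A : FinBij ⥤ C} (f : O.A ⟶ A) {𝒳 : Cell Base.sigma C}
    (ρ : 𝒳.p ⋙ O.A ⟶ 𝒳.Y) {𝒴 : Cell 𝔹 C} (α : 𝒴.p ⋙ X.M ⟶ 𝒴.Y) :
    (assoc A 𝒳 𝒴).push (odotTrans X.Δ (circTrans O.Δ f ρ) α) =
      circTrans X.Δ f (odotTrans X.Δ ρ α) := by
  refine NatTrans.ext (funext fun x : Wreath (Pull 𝒳.p 𝒴.E) =>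
    (push_assoc_odotTrans_app X.Δ _ α x).trans ?_)
  let z := (Wreath.map (Pull.snd 𝒳.p 𝒴.E ⋙ Wreath.map 𝒴.p)).obj x
  let φ := fun t : x.idx.carrier => ρ.app (x.lbl t).tree
  let ψ := fun t : x.idx.carrier => (Wreath.mapNat α).app (x.lbl t).wreath
  let g := (bigTensor C).map (Wreath.homOfFamily fun t => φ t ⊗ₘ (bigTensor C).map (ψ t))
  have hmap : (bigTensor C).map ((Wreath.mapNat X.Δ).app z) ≫ g =
      (bigTensor C).map ((Wreath.mapNat (odotTrans X.Δ ρ α)).app x) :=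
    ((bigTensor C).map_comp _ _).symm.trans (congrArg _ (Wreath.Hom.ext' (fun _ => rfl) fun t =>
      (Category.comp_id _).trans (odotTrans_app X.Δ ρ α (x.lbl t)).symm))
  have hnat := tensorHom_assoc_whiskerLeft (i := O.Δ.app ((Wreath.map (Wreath.forget 𝔹.B)).obj z))
    (f := f.app x.idx) (distrApp_natural φ ψ)
  rw [circTrans_app O.Δ f ρ]
  refine ((congrArg (_ ≫ _ ≫ ·) hnat).trans
    ((congrArg (_ ≫ ·) (Category.assoc _ _ _).symm).trans (Category.assoc _ _ _).symm)).trans ?_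
  refine (congrArg (· ≫ _) (X.coassoc_app z)).trans ((Category.assoc _ _ _).trans ?_)
  refine Eq.trans (congrArg (_ ≫ ·) ?_) (circTrans_app X.Δ f (odotTrans X.Δ ρ α) x).symm
  exact (whiskerLeft_comp_tensorHom _ _ _).trans (congrArg (_ ⊗ₘ ·) hmap)

end Coassociativity

section Coactions

variable {C : Type u} [Category.{v} C] [MonoidalCategory C] [SymmetricCategory C]
  [HasLimitsOfSize.{0, 0} C] {O : Cooperad C}

mutual

/-- The iterated cocomposition from the underlying functor of `X` to the value of `e`, which first
cocomposes `X` into as many factors as the outermost product of `e` has, then each factor into the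
corresponding subexpression. -/
noncomputable def Expr.coact : (e : Expr) → ∀ {𝔹 : Base} (X : Comodule O 𝔹), X.M ⟶ e.eval O.A X.M
  | .atom, _, X => 𝟙 X.M
  | .node e w, _, X =>
    ((Word.cons e w).cell O.A X.M).lift (circTrans X.Δ (e.coact O.self) (w.coact X))

/-- The iterated cocomposition of `X` with values in `w₁ ⊚ ⋯ ⊚ wₖ`, before the right Kan
extension. -/
noncomputable def Word.coact : (w : Word) → ∀ {𝔹 : Base} (X : Comodule O 𝔹),
    (w.cell O.A X.M).p ⋙ X.M ⟶ (w.cell O.A X.M).Y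
  | .single e, _, X => baseTrans (e.coact X)
  | .cons e w, _, X => circTrans X.Δ (e.coact O.self) (w.coact X)

end

lemma push_flatten_coact {𝔹 : Base} (X : Comodule O 𝔹) (w' w : Word) :
    (flatten O.A X.M w' w).push (odotTrans X.Δ (w'.coact O.self) (w.coact X)) =
      (w'.append w).coact X := by
  match w' with
  | .single e => exact push_collapse_odotTrans X.Δ (e.coact O.self) (w.coact X)
  | .cons e v =>
    refine (Hom.push_comp _ _ _).trans ((congrArg _ (X.push_assoc_odotTrans _ _ _)).trans
      ((push_circ_circTrans X.Δ _ _ _ _).trans ?_))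
    exact congrArg₂ (circTrans X.Δ · ·) (Category.comp_id (e.coact O.self))
      (push_flatten_coact X v w)

lemma push_coface_circTrans {𝔹 : Base} (X : Comodule O 𝔹) {𝒴 : Cell 𝔹 C} (α : 𝒴.p ⋙ X.M ⟶ 𝒴.Y) :
    (coface O.Δ 𝒴).push (circTrans X.Δ (𝟙 O.A) α) =
      circTrans X.Δ (𝟙 O.A) (circTrans X.Δ (𝟙 O.A) α) := by
  rw [coface, Hom.push_comp, Hom.push_comp]
  have h : (split O.Δ 𝒴).push (circTrans X.Δ (𝟙 O.A) α) =
      odotTrans X.Δ (circTrans O.Δ (𝟙 O.A) (baseTrans (𝔹 := Base.sigma) (𝟙 O.A))) α :=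
    congrArg (odotTrans X.Δ · α) (circTrans_id_baseTrans O.Δ).symm
  have hassoc := X.push_assoc_odotTrans (𝟙 O.A) (baseTrans (𝔹 := Base.sigma) (𝟙 O.A)) α
  rw [h, hassoc, push_circ_circTrans, push_collapse_odotTrans, Category.comp_id]

mutual

theorem EMap.coact_comp {𝔹 : Base} {X : Comodule O 𝔹} {e e' : Expr}
    {f : e.eval O.A X.M ⟶ e'.eval O.A X.M} : EMap X e e' f → e.coact X ≫ f = e'.coact X
  | .id _ _ => Category.comp_id _
  | .comp _ hf hg => by rw [← Category.assoc, hf.coact_comp, hg.coact_comp]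
  | .cocomp X => (Category.id_comp _).trans (congrArg _ (circTrans_id_baseTrans X.Δ).symm)
  | .kan _ hh => (lift_comp_hat _ _).trans (congrArg _ hh.push_coact)

theorem WMap.push_coact {𝔹 : Base} {X : Comodule O 𝔹} {w w' : Word}
    {h : Hom (w.cell O.A X.M) (w'.cell O.A X.M)} : WMap X w w' h → h.push (w.coact X) = w'.coact X
  | .id _ _ => Hom.push_id _
  | .single _ hf => (Hom.push_baseTrans_base _ _).trans (congrArg _ hf.coact_comp)
  | .cons X hf hh => (push_circ_circTrans X.Δ _ _ _ _).trans
      (congrArg₂ (circTrans X.Δ · ·) hf.coact_comp hh.push_coact)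
  | .paren X e w' w => (Hom.push_comp _ _ _).trans
      ((congrArg _ ((push_split_circTrans X.Δ _ _ _).trans
        (congrArg (odotTrans X.Δ · (w.coact X)) (whiskerLeft_lift _)))).trans
          (push_flatten_coact X (.cons e w') w))
  | .parenLast _ e w => (Hom.push_baseTrans_ofTrans _ _).trans (whiskerLeft_lift _)
  | .coface X w => push_coface_circTrans X (w.coact X)
  | .cofaceLast X => (Hom.push_baseTrans_ofTrans _ _).trans
      ((Category.id_comp _).trans (circTrans_id_baseTrans X.Δ).symm)

end

end Coactions

section Existence

variable {C : Type u} [Category.{v} C] [MonoidalCategory C] [SymmetricCategory C]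
  [HasLimitsOfSize.{0, 0} C] {O : Cooperad C}

/-- The number of factors minus one, so that `Word.flat w.length` has as many factors as `w`. -/
def Word.length : Word → ℕ
  | .single _ => 0
  | .cons _ w => w.length + 1

lemma WMap.exists_flat_flat_succ {𝔹 : Base} (X : Comodule O 𝔹) :
    (k : ℕ) → ∃ h, WMap X (.flat k) (.flat (k + 1)) h
  | 0 => ⟨_, .cofaceLast X⟩
  | k + 1 => by
    obtain ⟨h, hh⟩ := WMap.exists_flat_flat_succ X k
    exact ⟨_, .cons X (.id O.self .atom) hh⟩

lemma EMap.exists_atom_flat {𝔹 : Base} (X : Comodule O 𝔹) :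
    (k : ℕ) → ∃ f, EMap X .atom (.flat k) f
  | 0 => ⟨_, .id X .atom⟩
  | 1 => ⟨_, .cocomp X⟩
  | k + 2 => by
    obtain ⟨f, hf⟩ := EMap.exists_atom_flat X (k + 1)
    obtain ⟨h, hh⟩ := WMap.exists_flat_flat_succ X k
    exact ⟨_, .comp X hf (.kan X (.cons X (.id O.self .atom) hh))⟩

mutual

theorem EMap.exists_atom {𝔹 : Base} (X : Comodule O 𝔹) : (e : Expr) → ∃ f, EMap X .atom e f
  | .atom => ⟨_, .id X .atom⟩
  | .node e w => by
    obtain ⟨_, hflat⟩ := EMap.exists_atom_flat X (w.length + 1)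
    obtain ⟨_, he⟩ := EMap.exists_atom O.self e
    obtain ⟨_, hw⟩ := WMap.exists_flat_length X w
    exact ⟨_, .comp X hflat (.kan X (.cons X he hw))⟩

theorem WMap.exists_flat_length {𝔹 : Base} (X : Comodule O 𝔹) :
    (w : Word) → ∃ h, WMap X (.flat w.length) w h
  | .single e => by
    obtain ⟨_, he⟩ := EMap.exists_atom X e
    exact ⟨_, .single X he⟩
  | .cons e w => by
    obtain ⟨_, he⟩ := EMap.exists_atom O.self e
    obtain ⟨_, hw⟩ := WMap.exists_flat_length X w
    exact ⟨_, .cons X he hw⟩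

end

end Existence

end TreeSeq

theorem corollaryC_general {C : Type u} [Category.{v} C] [MonoidalCategory C]
    [SymmetricCategory C] [HasLimitsOfSize.{0, 0} C] {O : TreeSeq.Cooperad C}
    {𝔹 : TreeSeq.Base} (X : TreeSeq.Comodule O 𝔹) (e : TreeSeq.Expr) :
    ∃! f : X.M ⟶ e.eval O.A X.M, TreeSeq.EMap X .atom e f := by
  have unique {f : X.M ⟶ e.eval O.A X.M} (hf : TreeSeq.EMap X .atom e f) : f = e.coact X :=
    (Category.id_comp f).symm.trans hf.coact_comp
  obtain ⟨f, hf⟩ := TreeSeq.EMap.exists_atom X e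
  exact ⟨f, hf, fun g hg => (unique hg).trans (unique hf).symm⟩

theorem corollaryC {C : Type u} [Category.{v} C] [MonoidalCategory C] [SymmetricCategory C]
    [HasLimitsOfSize.{0, 0} C] (O : TreeSeq.Cooperad C) :
    (∀ (M : TreeSeq.Comodule O TreeSeq.Base.sigma) (k : ℕ),
      ∃! f : M.M ⟶ (TreeSeq.Expr.flat k).eval O.A M.M,
        TreeSeq.EMap M .atom (.flat k) f) ∧
    (∀ (c : TreeSeq.Coalgebra O) (k : ℕ),
      ∃! f : c.c ⟶ c.target k,
        ∃ F : c.toComodule.M ⟶ (TreeSeq.Expr.flat k).eval O.A c.toComodule.M,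
          TreeSeq.EMap c.toComodule .atom (.flat k) F ∧ F.app TreeSeq.emptySet = f) := by
  refine ⟨fun M k => corollaryC_general M (.flat k), fun c k => ?_⟩
  obtain ⟨F, hF, unique⟩ := corollaryC_general c.toComodule (.flat k)
  refine ⟨F.app TreeSeq.emptySet, ⟨F, hF, rfl⟩, ?_⟩
  rintro _ ⟨G, hG, rfl⟩
  rw [unique G hG]
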